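/- **Theorem (Operational correctness).** Consider the following first-order differentiable programming language. *Syntax.* Types are $T::=\mathtt{real}\mid\mathtt{unit}\mid T\times U$. Given are operation symbols $\mathrm{op}:T\to U$ and predicate symbols $\mathrm{pred}:T$. Terms $M,N,L$ and boolean terms $B$, taken up to renaming of bound variables, are $$M::=x\mid r\ (r\in\mathbb R)\mid M+N\mid \mathrm{op}(M)\mid \mathtt{let}\ x{:}T=M\ \mathtt{in}\ N\mid *\mid\langle M,N\rangle\mid\mathtt{fst}(M)\mid\mathtt{snd}(M)\mid\mathtt{if}\ B\ \mathtt{then}\ M\ \mathtt{else}\ N\mid \mathtt{letrec}\ f(x{:}T){:}U=M\ \mathtt{in}\ N\mid f(M)\mid \mathtt{rd}_L(x{:}T.\,N)(M),$$ $$B::=\mathrm{pred}(M)\mid\mathtt{true}\mid\mathtt{false}.$$ Judgements $\Phi\mid\Gamma\vdash M:T$ and $\Phi\mid\Gamma\vdash B$, where $\Gamma$ assigns types to finitely many ordinary variables and $\Phi$ assigns function types to finitely many function variables, are given by the usual simple typing rules; the body $M$ of a $\mathtt{letrec}$ is typed by $\Phi[f{:}T\to U]\mid x{:}T\vdash M:U$,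 so it has no ordinary variable but $x$; and $\mathtt{rd}_L(x{:}T.\,N)(M):T$ if $N:U$ in $\Gamma[x{:}T]$, $L:T$, $M:U$. *Values* are $V::=x\mid r\mid *\mid\langle V,W\rangle$, boolean values are $\mathtt{true},\mathtt{false}$, and *trace terms* $C,D$ are the terms without conditionals, function definitions, function applications and $\mathtt{rd}$. Zero values are $0_{\mathtt{real}}=0$, $0_{\mathtt{unit}}=*$, $0_{T\times U}=\langle 0_T,0_U\rangle$; the addition $C+_TD$ is $+$ at $\mathtt{real}$, evaluates both arguments and returns $*$ at $\mathtt{unit}$, and is componentwise (via $\mathtt{let}$) at products. *Environments.* A value environment $\rho:\Gamma$ maps each $x{:}T$ of $\Gamma$ to a closed value of type $T$; $\rho(V)$ is the result of substituting $\rho$ in $V$. A function environment $\varphi:\Phi$ maps each $f{:}T\to U$ of $\Phi$ to a closure of type $T\to U$; closures $\langle\varphi',f(x{:}T){:}U.\,M\rangle:T\to U$ consist of a function environment $\varphi':\Phi'$ and a term with $\Phi'[f{:}T\to U]\mid x{:}T\vdash M:U$. *Symbols.* For closed values, partial evaluation functions $\mathrm{ev}(\mathrm{op},V)$ and $\mathrm{bev}(\mathrm{pred},V)$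 are given. For each $\mathrm{op}:T\to U$ there are a smooth partial function with open domain $[\![\mathrm{op}]\!]:[\![T]\!]\rightharpoonup[\![U]\!]$ and a symbol $\mathrm{op}_r:T\times U\to T$, and for each $\mathrm{pred}:T$ a partial function $[\![\mathrm{pred}]\!]$ from $[\![T]\!]$ to the truth values for which the preimages of true and of false are open, such that (with $\simeq$ Kleene equality: both sides undefined, or both defined and equal) $[\![\mathrm{op}]\!]([\![V]\!])\simeq[\![\mathrm{ev}(\mathrm{op},V)]\!]$, $[\![\mathrm{pred}]\!]([\![V]\!])\simeq\mathrm{bev}(\mathrm{pred},V)$, and $[\![\mathrm{op}_r]\!](x,y)\simeq \mathrm d^r[\![\mathrm{op}]\!](x,y)$. Here $[\![T]\!]$ is the power of $\mathbb R$ with $[\![\mathtt{real}]\!]=\mathbb R$, $[\![\mathtt{unit}]\!]=\mathbb R^0$, and $[\![T\times U]\!]$ the concatenation of $[\![T]\!]$ and $[\![U]\!]$; and $\mathrm d^rg(x,y)\simeq J_x(g)^{t}\,y$ is the reverse-mode derivative, $J_x(g)$ being the Jacobian of $g$ at $x$; it is defined when $g$ is defined near $x$ and all its partial derivatives exist at $x$,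 and its value is $0$ if $g$ goes from or to $\mathbb R^0$. *Symbolic differentiation.* For a trace term $C:U$ over $\Gamma[x{:}T]$ and values $V:T$, $W:U$ over $\Gamma$, the trace term $W.\mathcal R_{x}(x.C)_V$ over $\Gamma$ is defined as follows (new bound variables are fresh, and $x$ is not free in $V,W$): - $W.\mathcal R_x(x.x)_V=W$; $W.\mathcal R_x(x.C)_V=0_T$ if $C$ is another variable, a constant, or $*$; - $W.\mathcal R_x(x.D+E)_V=W.\mathcal R_x(x.D)_V+_TW.\mathcal R_x(x.E)_V$; - $W.\mathcal R_x(x.\mathrm{op}(D))_V=\mathtt{let}\ x=V\ \mathtt{in}\ \mathtt{let}\ y=\mathrm{op}_r(\langle D,W\rangle)\ \mathtt{in}\ y.\mathcal R_x(x.D)_V$; - $W.\mathcal R_x(x.\mathtt{let}\ y{=}D\ \mathtt{in}\ E)_V=\mathtt{let}\ x=V\ \mathtt{in}\ \mathtt{let}\ y=D\ \mathtt{in}\ W.\mathcal R_x(x.E)_V+_T(\mathtt{let}\ \bar y=W.\mathcal R_y(y.E)_y\ \mathtt{in}\ \bar y.\mathcal R_x(x.D)_V)$; - $W.\mathcal R_x(x.\langle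 D,E\rangle)_V=\mathtt{let}\ \langle y,z\rangle=W\ \mathtt{in}\ y.\mathcal R_x(x.D)_V+_Tz.\mathcal R_x(x.E)_V$; - $W.\mathcal R_x(x.\mathtt{fst}(D))_V=\mathtt{let}\ x=V\ \mathtt{in}\ \mathtt{let}\ y=D\ \mathtt{in}\ \langle W,0\rangle.\mathcal R_x(x.D)_V$, and symmetrically with $\langle 0,W\rangle$ for $\mathtt{snd}$. *Operational semantics.* Evaluation contexts are $$E::=[\,]\mid E+N\mid V+E\mid\mathrm{op}(E)\mid\mathtt{let}\ x{=}E\ \mathtt{in}\ N\mid\langle E,N\rangle\mid\langle V,E\rangle\mid\mathtt{fst}(E)\mid\mathtt{snd}(E)\mid\mathtt{if}\ E_{\mathtt b}\ \mathtt{then}\ M\ \mathtt{else}\ N\mid f(E)\mid\mathtt{rd}_E(x.N)(M)\mid\mathtt{rd}_V(x.N)(E),$$ $E_{\mathtt b}::=[\,]\mid\mathrm{pred}(E)$. Redexes $R$ are $V+W$, $\mathrm{op}(V)$, $\mathtt{let}\ x{=}V\ \mathtt{in}\ N$, $\mathtt{fst}(V)$, $\mathtt{snd}(V)$, $\mathtt{if}\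 b\ \mathtt{then}\ M\ \mathtt{else}\ N$ with $b$ a boolean value, $\mathtt{letrec}$-terms, $f(V)$, $\mathtt{rd}_V(x.N)(W)$; boolean redexes $R_{\mathtt b}$ are $\mathrm{pred}(V)$. Ordinary evaluation $\varphi\mid\rho\vdash M\Rightarrow V$ (to closed values; for boolean terms, to boolean values) and symbolic evaluation $\varphi\mid\rho\vdash M\Rightarrow_sC$ (to trace terms) are the relations generated mutually by the following rules, where $\varphi\mid\rho$ is omitted if unchanged. Ordinary: $V\Rightarrow\rho(V)$, $b\Rightarrow b$. If $V\Rightarrow r$, $W\Rightarrow s$ then $V+W\Rightarrow r+s$. If $V\Rightarrow V'$ then $\mathrm{op}(V)\Rightarrow\mathrm{ev}(\mathrm{op},V')$ and $\mathrm{pred}(V)\Rightarrow\mathrm{bev}(\mathrm{pred},V')$, when these exist. If $V\Rightarrow V'$ and $\varphi\mid\rho[V'/x]\vdash N\Rightarrow W$ then $\mathtt{let}\ x{=}V\ \mathtt{in}\ N\Rightarrow W$. If $V\Rightarrow\langle W_1,W_2\rangle$ then $\mathtt{fst}(V)\Rightarrow W_1$, $\mathtt{snd}(V)\Rightarrow W_2$.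 $\mathtt{if}\ \mathtt{true}\ \mathtt{then}\ M\ \mathtt{else}\ N$ evaluates to what $M$ evaluates to, and with $\mathtt{false}$ to what $N$ evaluates to. If $\varphi[\langle\varphi,f(x{:}T){:}U.M\rangle/f]\mid\rho\vdash N\Rightarrow V$ then $\mathtt{letrec}\ f(x{:}T){:}U=M\ \mathtt{in}\ N\Rightarrow V$. If $\varphi(f)=\langle\varphi',f(x{:}T){:}U.M\rangle$, $V\Rightarrow V'$ and $\varphi'[\varphi(f)/f]\mid\{x\mapsto V'\}\vdash M\Rightarrow W$ then $f(V)\Rightarrow W$. If $\mathtt{rd}_V(x.N)(W)\Rightarrow_sC$ and $C\Rightarrow X$ then $\mathtt{rd}_V(x.N)(W)\Rightarrow X$. For a term or boolean evaluation context $E$: if $R\Rightarrow V$ and $\varphi\mid\rho[V/x]\vdash E[x]\Rightarrow W$, with $E$ nontrivial and $x$ new, then $E[R]\Rightarrow W$; if $R_{\mathtt b}\Rightarrow b$ and $E[b]\Rightarrow W$ then $E[R_{\mathtt b}]\Rightarrow W$. Symbolic: $M\Rightarrow_sM$ if $M$ is $V$, $V+W$, $\mathrm{op}(V)$, $\mathtt{fst}(V)$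 or $\mathtt{snd}(V)$. If $V\Rightarrow V'$ and $\varphi\mid\rho[V'/x]\vdash N\Rightarrow_sC$ then $\mathtt{let}\ x{=}V\ \mathtt{in}\ N\Rightarrow_s\mathtt{let}\ x{=}V\ \mathtt{in}\ C$, and $\mathtt{rd}_V(x.N)(W)\Rightarrow_sW.\mathcal R_x(x.C)_V$. The rules for $\mathtt{if}$ and $\mathtt{letrec}$ are as before. If $\varphi(f)=\langle\varphi',f(x{:}T){:}U.M\rangle$, $V\Rightarrow V'$ and $\varphi'[\varphi(f)/f]\mid\{x\mapsto V'\}\vdash M\Rightarrow_sC$ then $f(V)\Rightarrow_s\mathtt{let}\ x{=}V\ \mathtt{in}\ C$. If $R\Rightarrow_sC$, $C\Rightarrow V$ and $\varphi\mid\rho[V/x]\vdash E[x]\Rightarrow_sD$, with $E$ nontrivial and $x$ new, then $E[R]\Rightarrow_s\mathtt{let}\ x=C\ \mathtt{in}\ D$; if $R_{\mathtt b}\Rightarrow b$ and $E[b]\Rightarrow_sC$ then $E[R_{\mathtt b}]\Rightarrow_sC$. *Denotational semantics.* $[\![\Gamma]\!]$ is the concatenation of the $[\![T]\!]$ for $x{:}T$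 in $\Gamma$. For $\phi$ assigning to each $f{:}T\to U$ of $\Phi$ a partial function $[\![T]\!]\rightharpoonup[\![U]\!]$, and $\gamma\in[\![\Gamma]\!]$, the (possibly undefined) $[\![M]\!]\phi\gamma\in[\![T]\!]$ and truth value $[\![B]\!]\phi\gamma$ are defined by recursion, strictly and in the evident way, with: $[\![\mathtt{let}\ x{=}M\ \mathtt{in}\ N]\!]\phi\gamma\simeq[\![N]\!]\phi(\gamma[[\![M]\!]\phi\gamma/x])$; $[\![f(M)]\!]\phi\gamma\simeq\phi(f)([\![M]\!]\phi\gamma)$; $[\![\mathtt{letrec}\ f(x{:}T){:}U=M\ \mathtt{in}\ N]\!]\phi\gamma\simeq[\![N]\!](\phi[g/f])\gamma$, where $g$ is the least fixed point of $\alpha\mapsto(a\mapsto[\![M]\!](\phi[\alpha/f])\{x\mapsto a\})$, i.e. the union of its iterates starting from the nowhere defined function; and $[\![\mathtt{rd}_L(x.N)(M)]\!]\phi\gamma\simeq\mathrm d^r(a\mapsto[\![N]\!]\phi(\gamma[a/x]))([\![L]\!]\phi\gamma,[\![M]\!]\phi\gamma)$. Closed values and trace terms do not depend on $\phi$. Put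 $[\![\rho]\!]=([\![\rho(x)]\!])_x$, $[\![\varphi]\!]=([\![\varphi(f)]\!])_f$, and let $[\![\langle\varphi,f(x{:}T){:}U.M\rangle]\!]$ be the least fixed point of $\alpha\mapsto(a\mapsto[\![M]\!]([\![\varphi]\!][\alpha/f])\{x\mapsto a\})$. *Claim.* Suppose $\vdash\varphi:\Phi$ and $\vdash\rho:\Gamma$. 1. If $\Phi\mid\Gamma\vdash M:T$ and $\varphi\mid\rho\vdash M\Rightarrow V$, then $[\![M]\!][\![\varphi]\!][\![\rho]\!]$ is defined and equals $[\![V]\!]$. Likewise, if $\Phi\mid\Gamma\vdash B$ and $\varphi\mid\rho\vdash B\Rightarrow b$, then $[\![B]\!][\![\varphi]\!][\![\rho]\!]$ is defined and equals the truth value $b$. 2. If $\Phi\mid\Gamma\vdash M:T$ and $\varphi\mid\rho\vdash M\Rightarrow_sC$, then there is an open set $O\subseteq[\![\Gamma]\!]$ with $[\![\rho]\!]\in O$ such that $[\![M]\!][\![\varphi]\!]\gamma\simeq[\![C]\!]\gamma$ for all $\gamma\in O$. -/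

import Mathlib

/-!
# A first-order differentiable programming language

Terms are considered up to renaming of bound variables. This is made precise with de Bruijn
indices: a type environment is a list of types, a variable is a position in that list, and the most
recently bound variable is position `Ix.zero`. Terms are given together with their (unique) typing:
an element of `Term σ Φ Γ T` is a term `M` with `Φ ∣ Γ ⊢ M : T`, an element of `BTerm σ Φ Γ` is a
boolean term `B` with `Φ ∣ Γ ⊢ B`, and likewise for values, trace terms, contexts, environments.
-/

namespace DiffLang

universe u

open scoped Topology ContDiff

/-! ## Types, variables, environments -/

/-- The types of the language. -/
inductive Ty : Type
  | real : Ty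
  | unit : Ty
  | prod : Ty → Ty → Ty

/-- The two syntactic sorts: terms of a given type, and boolean terms. -/
inductive Kind : Type
  | ty : Ty → Kind
  | bool : Kind

/-- Function types `T → U`, as pairs `(T, U)`. -/
abbrev FTy := Ty × Ty

/-- Type environments. -/
abbrev Ctx := List Ty

/-- Function type environments. -/
abbrev FCtx := List FTy

/-- Typed variables: `Ix Γ a` is the type of positions of the list `Γ` that hold `a`. -/
inductive Ix {α : Type} : List α → α → Type
  | zero {l : List α} {a : α} : Ix (a :: l) a
  | succ {l : List α} {a b : α} : Ix l a → Ix (b :: l) a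

/-- A (finite) function that assigns to every variable of `l` an object of the matching sort. -/
def Env {α : Type} (P : α → Type*) (l : List α) := ∀ a : α, Ix l a → P a

/-- The empty environment. -/
def Env.nil {α : Type} {P : α → Type*} : Env P [] := fun _ i => nomatch i

/-- Extension of an environment by a new variable. -/
def Env.cons {α : Type} {P : α → Type*} {l : List α} {a : α} (p : P a) (e : Env P l) :
    Env P (a :: l)
  | _, .zero => p
  | _, .succ i => e _ i

/-- Renamings of ordinary variables. -/
abbrev Ren (Γ Δ : Ctx) := ∀ T : Ty, Ix Γ T → Ix Δ T

/-- A renaming, extended to one more bound variable. -/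
def Ren.lift {Γ Δ : Ctx} {S : Ty} (r : Ren Γ Δ) : Ren (S :: Γ) (S :: Δ)
  | _, .zero => .zero
  | _, .succ i => .succ (r _ i)

/-- The only renaming of no variables. -/
def Ren.nil {Δ : Ctx} : Ren [] Δ := fun _ i => nomatch i

/-- Weakening by one variable. -/
def wk {Γ : Ctx} {S : Ty} : Ren Γ (S :: Γ) := fun _ i => .succ i

/-- Weakening by two variables. -/
def wk2 {Γ : Ctx} {S₁ S₂ : Ty} : Ren Γ (S₂ :: S₁ :: Γ) := fun _ i => .succ (.succ i)

/-- Weakening by three variables. -/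
def wk3 {Γ : Ctx} {S₁ S₂ S₃ : Ty} : Ren Γ (S₃ :: S₂ :: S₁ :: Γ) :=
  fun _ i => .succ (.succ (.succ i))

/-- Composition of renamings (first `r`, then `s`). -/
def Ren.comp {Γ Δ Θ : Ctx} (s : Ren Δ Θ) (r : Ren Γ Δ) : Ren Γ Θ := fun _ i => s _ (r _ i)

/-! ## Values -/

/-- Values `V ::= x ∣ r ∣ ∗ ∣ ⟨V, W⟩`. -/
inductive Val : Ctx → Ty → Type
  | var {Γ : Ctx} {T : Ty} (x : Ix Γ T) : Val Γ T
  | const {Γ : Ctx} (r : ℝ) : Val Γ .real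
  | star {Γ : Ctx} : Val Γ .unit
  | pair {Γ : Ctx} {T U : Ty} (V : Val Γ T) (W : Val Γ U) : Val Γ (.prod T U)

/-- Closed values. -/
abbrev CVal (T : Ty) := Val [] T

/-- Renaming the variables of a value. -/
def Val.rename : {Γ Δ : Ctx} → {T : Ty} → Ren Γ Δ → Val Γ T → Val Δ T
  | _, _, _, r, .var x => .var (r _ x)
  | _, _, _, _, .const c => .const c
  | _, _, _, _, .star => .star
  | _, _, _, r, .pair V W => .pair (V.rename r) (W.rename r)

/-- Value environments `ρ : Γ`, assigning closed values to the variables of `Γ`. -/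
abbrev VEnv (Γ : Ctx) := Env CVal Γ

/-- The closed value `ρ(V)`. -/
def Val.subst {Γ : Ctx} (ρ : VEnv Γ) : {T : Ty} → Val Γ T → CVal T
  | _, .var x => ρ _ x
  | _, .const c => .const c
  | _, .star => .star
  | _, .pair V W => .pair (V.subst ρ) (W.subst ρ)

/-- The zero value `0_T`. -/
def Val.zero {Γ : Ctx} : (T : Ty) → Val Γ T
  | .real => .const 0
  | .unit => .star
  | .prod T U => .pair (Val.zero T) (Val.zero U)

/-! ## Denotations of types and of closed values -/

/-- The coordinates of `⟦T⟧`, a finite set with `|T|` elements. -/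
def Coord : Ty → Type
  | .real => Unit
  | .unit => Empty
  | .prod T U => Coord T ⊕ Coord U

instance Coord.fintype : (T : Ty) → Fintype (Coord T)
  | .real => inferInstanceAs (Fintype Unit)
  | .unit => inferInstanceAs (Fintype Empty)
  | .prod T U =>
    have := Coord.fintype T
    have := Coord.fintype U
    inferInstanceAs (Fintype (Coord T ⊕ Coord U))

instance Coord.decidableEq : (T : Ty) → DecidableEq (Coord T)
  | .real => inferInstanceAs (DecidableEq Unit)
  | .unit => inferInstanceAs (DecidableEq Empty)
  | .prod T U =>
    have := Coord.decidableEq T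
    have := Coord.decidableEq U
    inferInstanceAs (DecidableEq (Coord T ⊕ Coord U))

/-- The denotation `⟦T⟧`, the power of the reals with exponent `|T|`. -/
abbrev Den (T : Ty) := Coord T → ℝ

/-- The element of `⟦real⟧` given by a real number. -/
def Den.ofReal (r : ℝ) : Den .real := fun _ => r

/-- The element of `⟦unit⟧`. -/
def Den.star : Den .unit := fun i => nomatch (i : Empty)

/-- Vector concatenation `⟦T⟧ × ⟦U⟧ → ⟦T × U⟧`. -/
def Den.pair {T U : Ty} (a : Den T) (b : Den U) : Den (.prod T U) :=
  fun i => Sum.elim a b i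

/-- The first projection. -/
def Den.fst {T U : Ty} (c : Den (.prod T U)) : Den T :=
  fun i => c (Sum.inl i : Coord T ⊕ Coord U)

/-- The second projection. -/
def Den.snd {T U : Ty} (c : Den (.prod T U)) : Den U :=
  fun i => c (Sum.inr i : Coord T ⊕ Coord U)

/-- The product of the types of a type environment. -/
def Ty.ofCtx : Ctx → Ty
  | [] => .unit
  | T :: Γ => .prod T (Ty.ofCtx Γ)

/-- The denotation `⟦Γ⟧` of a type environment, again a power of the reals. -/
abbrev DCtx (Γ : Ctx) := Den (Ty.ofCtx Γ)

/-- The empty semantic environment. -/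
def DCtx.nil : DCtx [] := Den.star

/-- The semantic environment `γ[a/x]`, where `x` is a new variable. -/
def DCtx.cons {Γ : Ctx} {T : Ty} (a : Den T) (γ : DCtx Γ) : DCtx (T :: Γ) := Den.pair a γ

/-- The value `γ(x)` of a variable. -/
def DCtx.get : {Γ : Ctx} → {T : Ty} → Ix Γ T → DCtx Γ → Den T
  | _, _, .zero, γ => Den.fst (U := Ty.ofCtx _) γ
  | _, _, .succ i, γ => DCtx.get i (Den.snd (U := Ty.ofCtx _) γ)

/-- The denotation of a closed value. -/
def Val.den : {T : Ty} → CVal T → Den T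
  | _, .const r => Den.ofReal r
  | _, .star => Den.star
  | _, .pair V W => Den.pair V.den W.den

/-- The denotation `⟦ρ⟧` of a value environment. -/
def VEnv.den : {Γ : Ctx} → VEnv Γ → DCtx Γ
  | [], _ => DCtx.nil
  | _ :: _, ρ => DCtx.cons (ρ _ .zero).den (VEnv.den fun _ i => ρ _ (.succ i))

/-! ## Smooth partial functions and reverse-mode derivatives -/

open Classical in
/-- The extension of a partial function by `0` outside of its domain. -/
noncomputable def pext {X κ : Type} (f : X →. (κ → ℝ)) (x : X) : κ → ℝ :=
  if h : (f x).Dom then (f x).get h else 0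

/-- Smooth partial functions with open domain between powers of the reals. -/
def SmoothPFun {ι κ : Type} [Fintype ι] [Fintype κ] (f : (ι → ℝ) →. (κ → ℝ)) : Prop :=
  IsOpen f.Dom ∧ ContDiffOn ℝ ∞ (pext f) f.Dom

/-- Continuous partial functions to the discrete space of truth values. -/
def ContPred {ι : Type} (p : (ι → ℝ) →. Bool) : Prop := ∀ b : Bool, IsOpen {x | b ∈ p x}

/-- The partial derivative `∂_j (π_i ∘ f) (x)`, i.e. the entry `i, j` of the Jacobian of `f` at
`x` (meaningful if `f` is defined near `x` and this partial derivative exists). -/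
noncomputable def jacobian {ι κ : Type} [DecidableEq ι] (f : (ι → ℝ) →. (κ → ℝ)) (x : ι → ℝ) :
    Matrix κ ι ℝ :=
  fun i j => deriv (fun t : ℝ => pext f (Function.update x j t) i) (x j)

/-- The reverse-mode derivative `dʳ f (x, y) ≃ (J_x f)ᵗ · y`. It is defined if and only if `f` is
defined in a neighbourhood of `x` (if the domain of `f` is open: defined at `x`) and all partial
derivatives of all components of `f` exist at `x`. -/
noncomputable def revDeriv {ι κ : Type} [Fintype ι] [DecidableEq ι] [Fintype κ]
    (f : (ι → ℝ) →. (κ → ℝ)) (x : ι → ℝ) (y : κ → ℝ) : Part (ι → ℝ) where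
  Dom := (∀ᶠ z in 𝓝 x, (f z).Dom) ∧
    ∀ (i : κ) (j : ι), DifferentiableAt ℝ (fun t : ℝ => pext f (Function.update x j t) i) (x j)
  get _ := (jacobian f x).transpose.mulVec y

/-! ## Operation and predicate symbols -/

/-- Operation symbols `op : T → U` and predicate symbols `pred : T`, with their evaluation
functions, their interpretations as smooth, respectively continuous, partial functions that agree
with the evaluation functions, and an operation symbol `op_r : T × U → T` for each `op : T → U`
that denotes the reverse-mode derivative of `op`. -/
structure Signature where
  Op : Ty → Ty → Type u
  Pred : Ty → Type u
  /-- `op_r` -/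
  rev : ∀ {T U : Ty}, Op T U → Op (.prod T U) T
  /-- evaluation of operation symbols, a partial function -/
  ev : ∀ {T U : Ty}, Op T U → CVal T → Part (CVal U)
  /-- evaluation of predicate symbols, a partial function -/
  bev : ∀ {T : Ty}, Pred T → CVal T → Part Bool
  /-- `⟦op⟧` -/
  opDen : ∀ {T U : Ty}, Op T U → (Den T →. Den U)
  /-- `⟦pred⟧` -/
  predDen : ∀ {T : Ty}, Pred T → (Den T →. Bool)
  opDen_smooth : ∀ {T U : Ty} (o : Op T U), SmoothPFun (opDen o)
  predDen_cont : ∀ {T : Ty} (p : Pred T), ContPred (predDen p)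
  opDen_ev : ∀ {T U : Ty} (o : Op T U) (V : CVal T), opDen o V.den = (ev o V).map Val.den
  predDen_bev : ∀ {T : Ty} (p : Pred T) (V : CVal T), predDen p V.den = bev p V
  opDen_rev : ∀ {T U : Ty} (o : Op T U) (x : Den T) (y : Den U),
    opDen (rev o) (Den.pair x y) = revDeriv (opDen o) x y

/-! ## Terms -/

/-- Terms and boolean terms. `letrec M N` is `letrec f(x : T) : U = M in N`; its function body `M`
has no ordinary variable but the parameter `x`. `rd N L M` is the reverse-mode derivative of
`x : T ↦ N` at `L`, evaluated at `M`. -/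
inductive Expr (σ : Signature.{u}) : FCtx → Ctx → Kind → Type u
  | var {Φ : FCtx} {Γ : Ctx} {T : Ty} (x : Ix Γ T) : Expr σ Φ Γ (.ty T)
  | const {Φ : FCtx} {Γ : Ctx} (r : ℝ) : Expr σ Φ Γ (.ty .real)
  | add {Φ : FCtx} {Γ : Ctx} (M N : Expr σ Φ Γ (.ty .real)) : Expr σ Φ Γ (.ty .real)
  | op {Φ : FCtx} {Γ : Ctx} {T U : Ty} (o : σ.Op T U) (M : Expr σ Φ Γ (.ty T)) :
      Expr σ Φ Γ (.ty U)
  | letin {Φ : FCtx} {Γ : Ctx} {T U : Ty} (M : Expr σ Φ Γ (.ty T))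
      (N : Expr σ Φ (T :: Γ) (.ty U)) : Expr σ Φ Γ (.ty U)
  | star {Φ : FCtx} {Γ : Ctx} : Expr σ Φ Γ (.ty .unit)
  | pair {Φ : FCtx} {Γ : Ctx} {T U : Ty} (M : Expr σ Φ Γ (.ty T)) (N : Expr σ Φ Γ (.ty U)) :
      Expr σ Φ Γ (.ty (.prod T U))
  | fst {Φ : FCtx} {Γ : Ctx} {T U : Ty} (M : Expr σ Φ Γ (.ty (.prod T U))) : Expr σ Φ Γ (.ty T)
  | snd {Φ : FCtx} {Γ : Ctx} {T U : Ty} (M : Expr σ Φ Γ (.ty (.prod T U))) : Expr σ Φ Γ (.ty U)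
  | ite {Φ : FCtx} {Γ : Ctx} {T : Ty} (B : Expr σ Φ Γ .bool) (M N : Expr σ Φ Γ (.ty T)) :
      Expr σ Φ Γ (.ty T)
  | letrec {Φ : FCtx} {Γ : Ctx} {T U S : Ty} (M : Expr σ ((T, U) :: Φ) [T] (.ty U))
      (N : Expr σ ((T, U) :: Φ) Γ (.ty S)) : Expr σ Φ Γ (.ty S)
  | app {Φ : FCtx} {Γ : Ctx} {T U : Ty} (f : Ix Φ (T, U)) (M : Expr σ Φ Γ (.ty T)) :
      Expr σ Φ Γ (.ty U)
  | rd {Φ : FCtx} {Γ : Ctx} {T U : Ty} (N : Expr σ Φ (T :: Γ) (.ty U)) (L : Expr σ Φ Γ (.ty T))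
      (M : Expr σ Φ Γ (.ty U)) : Expr σ Φ Γ (.ty T)
  | pred {Φ : FCtx} {Γ : Ctx} {T : Ty} (p : σ.Pred T) (M : Expr σ Φ Γ (.ty T)) : Expr σ Φ Γ .bool
  | bool {Φ : FCtx} {Γ : Ctx} (b : Bool) : Expr σ Φ Γ .bool

/-- Terms `M` with `Φ ∣ Γ ⊢ M : T`. -/
abbrev Term (σ : Signature.{u}) (Φ : FCtx) (Γ : Ctx) (T : Ty) := Expr σ Φ Γ (.ty T)

/-- Boolean terms `B` with `Φ ∣ Γ ⊢ B`. -/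
abbrev BTerm (σ : Signature.{u}) (Φ : FCtx) (Γ : Ctx) := Expr σ Φ Γ .bool

/-- Trace terms: terms without conditionals, function definitions or applications, or
differentiations. -/
inductive Trace (σ : Signature.{u}) : Ctx → Ty → Type u
  | var {Γ : Ctx} {T : Ty} (x : Ix Γ T) : Trace σ Γ T
  | const {Γ : Ctx} (r : ℝ) : Trace σ Γ .real
  | add {Γ : Ctx} (C D : Trace σ Γ .real) : Trace σ Γ .real
  | op {Γ : Ctx} {T U : Ty} (o : σ.Op T U) (C : Trace σ Γ T) : Trace σ Γ U
  | letin {Γ : Ctx} {T U : Ty} (C : Trace σ Γ T) (D : Trace σ (T :: Γ) U) : Trace σ Γ U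
  | star {Γ : Ctx} : Trace σ Γ .unit
  | pair {Γ : Ctx} {T U : Ty} (C : Trace σ Γ T) (D : Trace σ Γ U) : Trace σ Γ (.prod T U)
  | fst {Γ : Ctx} {T U : Ty} (C : Trace σ Γ (.prod T U)) : Trace σ Γ T
  | snd {Γ : Ctx} {T U : Ty} (C : Trace σ Γ (.prod T U)) : Trace σ Γ U

section Terms

variable {σ : Signature.{u}}

/-- Renaming the ordinary variables of a term. -/
def Expr.rename : {Φ : FCtx} → {Γ Δ : Ctx} → {k : Kind} → Ren Γ Δ → Expr σ Φ Γ k → Expr σ Φ Δ k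
  | _, _, _, _, r, .var x => .var (r _ x)
  | _, _, _, _, _, .const c => .const c
  | _, _, _, _, r, .add M N => .add (M.rename r) (N.rename r)
  | _, _, _, _, r, .op o M => .op o (M.rename r)
  | _, _, _, _, r, .letin M N => .letin (M.rename r) (N.rename r.lift)
  | _, _, _, _, _, .star => .star
  | _, _, _, _, r, .pair M N => .pair (M.rename r) (N.rename r)
  | _, _, _, _, r, .fst M => .fst (M.rename r)
  | _, _, _, _, r, .snd M => .snd (M.rename r)
  | _, _, _, _, r, .ite B M N => .ite (B.rename r) (M.rename r) (N.rename r)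
  | _, _, _, _, r, .letrec M N => .letrec M (N.rename r)
  | _, _, _, _, r, .app f M => .app f (M.rename r)
  | _, _, _, _, r, .rd N L M => .rd (N.rename r.lift) (L.rename r) (M.rename r)
  | _, _, _, _, r, .pred p M => .pred p (M.rename r)
  | _, _, _, _, _, .bool b => .bool b

/-- Renaming the variables of a trace term. -/
def Trace.rename : {Γ Δ : Ctx} → {T : Ty} → Ren Γ Δ → Trace σ Γ T → Trace σ Δ T
  | _, _, _, r, .var x => .var (r _ x)
  | _, _, _, _, .const c => .const c
  | _, _, _, r, .add C D => .add (C.rename r) (D.rename r)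
  | _, _, _, r, .op o C => .op o (C.rename r)
  | _, _, _, r, .letin C D => .letin (C.rename r) (D.rename r.lift)
  | _, _, _, _, .star => .star
  | _, _, _, r, .pair C D => .pair (C.rename r) (D.rename r)
  | _, _, _, r, .fst C => .fst (C.rename r)
  | _, _, _, r, .snd C => .snd (C.rename r)

/-- Values are trace terms. -/
def Val.toTrace : {Γ : Ctx} → {T : Ty} → Val Γ T → Trace σ Γ T
  | _, _, .var x => .var x
  | _, _, .const c => .const c
  | _, _, .star => .star
  | _, _, .pair V W => .pair V.toTrace W.toTrace

/-- Trace terms are terms. -/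
def Trace.toTerm {Φ : FCtx} : {Γ : Ctx} → {T : Ty} → Trace σ Γ T → Term σ Φ Γ T
  | _, _, .var x => .var x
  | _, _, .const c => .const c
  | _, _, .add C D => .add C.toTerm D.toTerm
  | _, _, .op o C => .op o C.toTerm
  | _, _, .letin C D => .letin C.toTerm D.toTerm
  | _, _, .star => .star
  | _, _, .pair C D => .pair C.toTerm D.toTerm
  | _, _, .fst C => .fst C.toTerm
  | _, _, .snd C => .snd C.toTerm

/-- Values are terms. -/
def Val.toTerm {Φ : FCtx} : {Γ : Ctx} → {T : Ty} → Val Γ T → Term σ Φ Γ T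
  | _, _, .var x => .var x
  | _, _, .const c => .const c
  | _, _, .star => .star
  | _, _, .pair V W => .pair V.toTerm W.toTerm

/-! ## Symbolic differentiation of trace terms -/

/-- `let ⟨y : T, z : U⟩ = C in D`, i.e. `let p = C in let y = fst p in let z = snd p in D`, where
`p` is not used in `D`. In `D`, `z` is position 0, `y` is position 1, and `p` is position 2. -/
def Trace.letPair {Γ : Ctx} {T U S : Ty} (C : Trace σ Γ (.prod T U))
    (D : Trace σ (U :: T :: Ty.prod T U :: Γ) S) : Trace σ Γ S :=
  .letin C (.letin (.fst (.var .zero)) (.letin (.snd (.var (.succ .zero))) D))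

/-- The addition `C +_T D` at an arbitrary type. -/
def Trace.addT : {Γ : Ctx} → (T : Ty) → Trace σ Γ T → Trace σ Γ T → Trace σ Γ T
  | _, .real, C, D => .add C D
  | _, .unit, C, D => .letin C (.letin (D.rename wk) .star)
  | _, .prod T U, C, D =>
    .letPair C (.letPair (D.rename wk3)
      (.pair (Trace.addT T (.var (.succ (.succ (.succ (.succ .zero))))) (.var (.succ .zero)))
        (Trace.addT U (.var (.succ (.succ (.succ .zero)))) (.var .zero))))

/-- Symbolic differentiation. For a trace term `C`, a renaming `r` of its variables into those of
`x : T, Γ`, and values `V : T` and `W : U` over `Γ`, the trace term `revAux C r V W` is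
`W.ℛ_{x : T} (x. C[r])_V`. -/
def Trace.revAux : {Δ Γ : Ctx} → {T U : Ty} → Trace σ Δ U → Ren Δ (T :: Γ) → Val Γ T → Val Γ U →
    Trace σ Γ T
  | _, _, T, _, .var y, r, _, W =>
    match r _ y, W with
    | .zero, W => W.toTrace
    | .succ _, _ => (Val.zero T).toTrace
  | _, _, T, _, .const _, _, _, _ => (Val.zero T).toTrace
  | _, _, T, _, .add D E, r, V, W => .addT T (D.revAux r V W) (E.revAux r V W)
  | _, _, _, _, .op o D, r, V, W =>
    -- let x = V in let y = W.op_r(D) in y.ℛ_x (x. D)_V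
    .letin V.toTrace
      (.letin (.op (σ.rev o) (.pair (D.rename r) (W.rename wk).toTrace))
        (D.revAux (wk2.lift.comp r) (V.rename wk2) (.var .zero)))
  | _, _, T, _, .letin D E, r, V, W =>
    -- let x = V in let y = D in W.ℛ_x (x. E)_V + (let y' = W.ℛ_y (y. E)_y in y'.ℛ_x (x. D)_V)
    .letin V.toTrace
      (.letin (D.rename r)
        (.addT T
          (E.revAux (Env.cons (P := fun S => Ix _ S) (.succ .zero) (wk2.lift.comp r))
            (V.rename wk2) (W.rename wk2))
          (.letin
            (E.revAux (Env.cons (P := fun S => Ix _ S) .zero (wk2.comp r))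
              (.var .zero) (W.rename wk2))
            (D.revAux (wk3.lift.comp r) (V.rename wk3) (.var .zero)))))
  | _, _, T, _, .star, _, _, _ => (Val.zero T).toTrace
  | _, _, T, _, .pair D E, r, V, W =>
    -- let ⟨y, z⟩ = W in y.ℛ_x (x. D)_V + z.ℛ_x (x. E)_V
    .letPair W.toTrace
      (.addT T (D.revAux (wk3.lift.comp r) (V.rename wk3) (.var (.succ .zero)))
        (E.revAux (wk3.lift.comp r) (V.rename wk3) (.var .zero)))
  | _, _, _, _, .fst D, r, V, W =>
    -- let x = V in let y = D in ⟨W, 0⟩.ℛ_x (x. D)_V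
    .letin V.toTrace
      (.letin (D.rename r)
        (D.revAux (wk2.lift.comp r) (V.rename wk2) (.pair (W.rename wk2) (Val.zero _))))
  | _, _, _, _, .snd D, r, V, W =>
    -- let x = V in let y = D in ⟨0, W⟩.ℛ_x (x. D)_V
    .letin V.toTrace
      (.letin (D.rename r)
        (D.revAux (wk2.lift.comp r) (V.rename wk2) (.pair (Val.zero _) (W.rename wk2))))

/-- The trace term `W.ℛ_{x : T} (x. C)_V`. -/
def Trace.rev {Γ : Ctx} {T U : Ty} (C : Trace σ (T :: Γ) U) (V : Val Γ T) (W : Val Γ U) :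
    Trace σ Γ T :=
  C.revAux (fun _ i => i) V W

end Terms

/-! ## Evaluation contexts, redexes, closures -/

/-- Evaluation contexts. `ECtx σ Φ Γ h k` has a hole for terms (or boolean terms) of kind `h` and
yields a term (or a boolean term) of kind `k`. -/
inductive ECtx (σ : Signature.{u}) (Φ : FCtx) (Γ : Ctx) (h : Kind) : Kind → Type u
  | hole : ECtx σ Φ Γ h h
  | addL (E : ECtx σ Φ Γ h (.ty .real)) (N : Term σ Φ Γ .real) : ECtx σ Φ Γ h (.ty .real)
  | addR (V : Val Γ .real) (E : ECtx σ Φ Γ h (.ty .real)) : ECtx σ Φ Γ h (.ty .real)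
  | op {T U : Ty} (o : σ.Op T U) (E : ECtx σ Φ Γ h (.ty T)) : ECtx σ Φ Γ h (.ty U)
  | letin {T U : Ty} (E : ECtx σ Φ Γ h (.ty T)) (N : Term σ Φ (T :: Γ) U) : ECtx σ Φ Γ h (.ty U)
  | pairL {T U : Ty} (E : ECtx σ Φ Γ h (.ty T)) (N : Term σ Φ Γ U) : ECtx σ Φ Γ h (.ty (.prod T U))
  | pairR {T U : Ty} (V : Val Γ T) (E : ECtx σ Φ Γ h (.ty U)) : ECtx σ Φ Γ h (.ty (.prod T U))
  | fst {T U : Ty} (E : ECtx σ Φ Γ h (.ty (.prod T U))) : ECtx σ Φ Γ h (.ty T)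
  | snd {T U : Ty} (E : ECtx σ Φ Γ h (.ty (.prod T U))) : ECtx σ Φ Γ h (.ty U)
  | ite {T : Ty} (E : ECtx σ Φ Γ h .bool) (M N : Term σ Φ Γ T) : ECtx σ Φ Γ h (.ty T)
  | app {T U : Ty} (f : Ix Φ (T, U)) (E : ECtx σ Φ Γ h (.ty T)) : ECtx σ Φ Γ h (.ty U)
  | rdL {T U : Ty} (N : Term σ Φ (T :: Γ) U) (E : ECtx σ Φ Γ h (.ty T)) (M : Term σ Φ Γ U) :
      ECtx σ Φ Γ h (.ty T)
  | rdR {T U : Ty} (N : Term σ Φ (T :: Γ) U) (V : Val Γ T) (E : ECtx σ Φ Γ h (.ty U)) :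
      ECtx σ Φ Γ h (.ty T)
  | pred {T : Ty} (p : σ.Pred T) (E : ECtx σ Φ Γ h (.ty T)) : ECtx σ Φ Γ h .bool

section Contexts

variable {σ : Signature.{u}} {Φ : FCtx} {Γ : Ctx} {h : Kind}

/-- The term `E[M]`. -/
def ECtx.plug (M : Expr σ Φ Γ h) : {k : Kind} → ECtx σ Φ Γ h k → Expr σ Φ Γ k
  | _, .hole => M
  | _, .addL E N => .add (E.plug M) N
  | _, .addR V E => .add V.toTerm (E.plug M)
  | _, .op o E => .op o (E.plug M)
  | _, .letin E N => .letin (E.plug M) N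
  | _, .pairL E N => .pair (E.plug M) N
  | _, .pairR V E => .pair V.toTerm (E.plug M)
  | _, .fst E => .fst (E.plug M)
  | _, .snd E => .snd (E.plug M)
  | _, .ite E N P => .ite (E.plug M) N P
  | _, .app f E => .app f (E.plug M)
  | _, .rdL N E P => .rd N (E.plug M) P
  | _, .rdR N V E => .rd N V.toTerm (E.plug M)
  | _, .pred p E => .pred p (E.plug M)

/-- Renaming the ordinary variables of an evaluation context. -/
def ECtx.rename {Δ : Ctx} (r : Ren Γ Δ) : {k : Kind} → ECtx σ Φ Γ h k → ECtx σ Φ Δ h k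
  | _, .hole => .hole
  | _, .addL E N => .addL (E.rename r) (N.rename r)
  | _, .addR V E => .addR (V.rename r) (E.rename r)
  | _, .op o E => .op o (E.rename r)
  | _, .letin E N => .letin (E.rename r) (N.rename r.lift)
  | _, .pairL E N => .pairL (E.rename r) (N.rename r)
  | _, .pairR V E => .pairR (V.rename r) (E.rename r)
  | _, .fst E => .fst (E.rename r)
  | _, .snd E => .snd (E.rename r)
  | _, .ite E N P => .ite (E.rename r) (N.rename r) (P.rename r)
  | _, .app f E => .app f (E.rename r)
  | _, .rdL N E P => .rdL (N.rename r.lift) (E.rename r) (P.rename r)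
  | _, .rdR N V E => .rdR (N.rename r.lift) (V.rename r) (E.rename r)
  | _, .pred p E => .pred p (E.rename r)

/-- The context `[ ]` is the only trivial one. -/
def ECtx.Nontrivial : {k : Kind} → ECtx σ Φ Γ h k → Prop
  | _, .hole => False
  | _, _ => True

/-- The term `E[x]`, where `x : T` is a new variable. -/
def ECtx.plugVar {T : Ty} {k : Kind} (E : ECtx σ Φ Γ (.ty T) k) : Expr σ Φ (T :: Γ) k :=
  (E.rename wk).plug (.var .zero)

/-- Redexes and boolean redexes. -/
inductive IsRedex : {k : Kind} → Expr σ Φ Γ k → Prop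
  | add (V W : Val Γ .real) : IsRedex (.add V.toTerm W.toTerm)
  | op {T U : Ty} (o : σ.Op T U) (V : Val Γ T) : IsRedex (.op o V.toTerm)
  | letin {T U : Ty} (V : Val Γ T) (N : Term σ Φ (T :: Γ) U) : IsRedex (.letin V.toTerm N)
  | fst {T U : Ty} (V : Val Γ (.prod T U)) : IsRedex (.fst V.toTerm)
  | snd {T U : Ty} (V : Val Γ (.prod T U)) : IsRedex (.snd V.toTerm)
  | ite {T : Ty} (b : Bool) (M N : Term σ Φ Γ T) : IsRedex (.ite (.bool b) M N)
  | letrec {T U S : Ty} (M : Term σ ((T, U) :: Φ) [T] U) (N : Term σ ((T, U) :: Φ) Γ S) :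
      IsRedex (.letrec M N)
  | app {T U : Ty} (f : Ix Φ (T, U)) (V : Val Γ T) : IsRedex (.app f V.toTerm)
  | rd {T U : Ty} (N : Term σ Φ (T :: Γ) U) (V : Val Γ T) (W : Val Γ U) :
      IsRedex (.rd N V.toTerm W.toTerm)
  | pred {T : Ty} (p : σ.Pred T) (V : Val Γ T) : IsRedex (.pred p V.toTerm)

end Contexts

/-- Recursive function closures `⟨φ, f(x : T) : U. M⟩ : T → U`, where `φ` is a function
environment. -/
inductive Clo (σ : Signature.{u}) : Ty → Ty → Type u
  | mk {Φ : FCtx} {T U : Ty} (φ : ∀ F : FTy, Ix Φ F → Clo σ F.1 F.2)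
      (M : Term σ ((T, U) :: Φ) [T] U) : Clo σ T U

/-- Function environments `φ : Φ`. -/
abbrev FEnv (σ : Signature.{u}) (Φ : FCtx) := Env (fun F : FTy => Clo σ F.1 F.2) Φ

/-- The function environment `φ[Cl/f]`, where `f : T → U` is a new function variable. -/
def FEnv.cons {σ : Signature.{u}} {Φ : FCtx} {T U : Ty} (c : Clo σ T U) (φ : FEnv σ Φ) :
    FEnv σ ((T, U) :: Φ) :=
  Env.cons (P := fun F : FTy => Clo σ F.1 F.2) (a := (T, U)) c φ

/-! ## Operational semantics -/

/-- The results of ordinary evaluation: closed values for terms, and `true` and `false` for boolean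
terms. -/
abbrev Res : Kind → Type
  | .ty T => CVal T
  | .bool => Bool

mutual

/-- Ordinary evaluation `φ ∣ ρ ⊢ M ⇒ V`, of terms and of boolean terms. -/
inductive Eval {σ : Signature.{u}} : {Φ : FCtx} → {Γ : Ctx} → {k : Kind} →
    FEnv σ Φ → VEnv Γ → Expr σ Φ Γ k → Res k → Prop
  | val {Φ : FCtx} {Γ : Ctx} {φ : FEnv σ Φ} {ρ : VEnv Γ} {T : Ty} (V : Val Γ T) :
      Eval (k := .ty T) φ ρ V.toTerm (V.subst ρ)
  | bool {Φ : FCtx} {Γ : Ctx} {φ : FEnv σ Φ} {ρ : VEnv Γ} (b : Bool) :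
      Eval (k := .bool) φ ρ (.bool b) b
  | add {Φ : FCtx} {Γ : Ctx} {φ : FEnv σ Φ} {ρ : VEnv Γ} {V W : Val Γ .real} {r s : ℝ} :
      Eval (k := .ty .real) φ ρ V.toTerm (.const r) →
      Eval (k := .ty .real) φ ρ W.toTerm (.const s) →
      Eval (k := .ty .real) φ ρ (.add V.toTerm W.toTerm) (.const (r + s))
  | op {Φ : FCtx} {Γ : Ctx} {φ : FEnv σ Φ} {ρ : VEnv Γ} {T U : Ty} {o : σ.Op T U} {V : Val Γ T}
      {V' : CVal T} {W : CVal U} :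
      Eval (k := .ty T) φ ρ V.toTerm V' →
      W ∈ σ.ev o V' →
      Eval (k := .ty U) φ ρ (.op o V.toTerm) W
  | letin {Φ : FCtx} {Γ : Ctx} {φ : FEnv σ Φ} {ρ : VEnv Γ} {T U : Ty} {V : Val Γ T}
      {N : Term σ Φ (T :: Γ) U} {V' : CVal T} {W : CVal U} :
      Eval (k := .ty T) φ ρ V.toTerm V' →
      Eval (k := .ty U) φ (Env.cons V' ρ) N W →
      Eval (k := .ty U) φ ρ (.letin V.toTerm N) W
  | fst {Φ : FCtx} {Γ : Ctx} {φ : FEnv σ Φ} {ρ : VEnv Γ} {T U : Ty} {V : Val Γ (.prod T U)}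
      {W₁ : CVal T} {W₂ : CVal U} :
      Eval (k := .ty (.prod T U)) φ ρ V.toTerm (.pair W₁ W₂) →
      Eval (k := .ty T) φ ρ (.fst V.toTerm) W₁
  | snd {Φ : FCtx} {Γ : Ctx} {φ : FEnv σ Φ} {ρ : VEnv Γ} {T U : Ty} {V : Val Γ (.prod T U)}
      {W₁ : CVal T} {W₂ : CVal U} :
      Eval (k := .ty (.prod T U)) φ ρ V.toTerm (.pair W₁ W₂) →
      Eval (k := .ty U) φ ρ (.snd V.toTerm) W₂
  | iteTrue {Φ : FCtx} {Γ : Ctx} {φ : FEnv σ Φ} {ρ : VEnv Γ} {T : Ty} {M N : Term σ Φ Γ T}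
      {V : CVal T} :
      Eval (k := .ty T) φ ρ M V →
      Eval (k := .ty T) φ ρ (.ite (.bool true) M N) V
  | iteFalse {Φ : FCtx} {Γ : Ctx} {φ : FEnv σ Φ} {ρ : VEnv Γ} {T : Ty} {M N : Term σ Φ Γ T}
      {V : CVal T} :
      Eval (k := .ty T) φ ρ N V →
      Eval (k := .ty T) φ ρ (.ite (.bool false) M N) V
  | letrec {Φ : FCtx} {Γ : Ctx} {φ : FEnv σ Φ} {ρ : VEnv Γ} {T U S : Ty}
      {M : Term σ ((T, U) :: Φ) [T] U} {N : Term σ ((T, U) :: Φ) Γ S} {V : CVal S} :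
      Eval (k := .ty S) (FEnv.cons (.mk φ M) φ) ρ N V →
      Eval (k := .ty S) φ ρ (.letrec M N) V
  | app {Φ Φ' : FCtx} {Γ : Ctx} {φ : FEnv σ Φ} {ρ : VEnv Γ} {T U : Ty} {f : Ix Φ (T, U)}
      {V : Val Γ T} {φ' : FEnv σ Φ'} {M : Term σ ((T, U) :: Φ') [T] U} {V' : CVal T}
      {W : CVal U} :
      φ (T, U) f = .mk φ' M →
      Eval (k := .ty T) φ ρ V.toTerm V' →
      Eval (k := .ty U) (FEnv.cons (φ (T, U) f) φ') (Env.cons V' Env.nil) M W →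
      Eval (k := .ty U) φ ρ (.app f V.toTerm) W
  | rd {Φ : FCtx} {Γ : Ctx} {φ : FEnv σ Φ} {ρ : VEnv Γ} {T U : Ty} {N : Term σ Φ (T :: Γ) U}
      {V : Val Γ T} {W : Val Γ U} {C : Trace σ Γ T} {X : CVal T} :
      SymEval φ ρ (.rd N V.toTerm W.toTerm) C →
      Eval (k := .ty T) φ ρ C.toTerm X →
      Eval (k := .ty T) φ ρ (.rd N V.toTerm W.toTerm) X
  | pred {Φ : FCtx} {Γ : Ctx} {φ : FEnv σ Φ} {ρ : VEnv Γ} {T : Ty} {p : σ.Pred T} {V : Val Γ T}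
      {V' : CVal T} {b : Bool} :
      Eval (k := .ty T) φ ρ V.toTerm V' →
      b ∈ σ.bev p V' →
      Eval (k := .bool) φ ρ (.pred p V.toTerm) b
  | ctx {Φ : FCtx} {Γ : Ctx} {φ : FEnv σ Φ} {ρ : VEnv Γ} {T : Ty} {k : Kind}
      {E : ECtx σ Φ Γ (.ty T) k} {R : Term σ Φ Γ T} {V : CVal T} {W : Res k} :
      E.Nontrivial → IsRedex R →
      Eval (k := .ty T) φ ρ R V →
      Eval φ (Env.cons V ρ) E.plugVar W →
      Eval φ ρ (E.plug R) W
  | bctx {Φ : FCtx} {Γ : Ctx} {φ : FEnv σ Φ} {ρ : VEnv Γ} {k : Kind}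
      {E : ECtx σ Φ Γ .bool k} {R : BTerm σ Φ Γ} {b : Bool} {W : Res k} :
      IsRedex R →
      Eval (k := .bool) φ ρ R b →
      Eval φ ρ (E.plug (.bool b)) W →
      Eval φ ρ (E.plug R) W

/-- Symbolic evaluation `φ ∣ ρ ⊢ M ⇒ₛ C` of terms to trace terms. -/
inductive SymEval {σ : Signature.{u}} : {Φ : FCtx} → {Γ : Ctx} → {T : Ty} →
    FEnv σ Φ → VEnv Γ → Term σ Φ Γ T → Trace σ Γ T → Prop
  | val {Φ : FCtx} {Γ : Ctx} {φ : FEnv σ Φ} {ρ : VEnv Γ} {T : Ty} (V : Val Γ T) :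
      SymEval φ ρ V.toTerm V.toTrace
  | add {Φ : FCtx} {Γ : Ctx} {φ : FEnv σ Φ} {ρ : VEnv Γ} (V W : Val Γ .real) :
      SymEval φ ρ (.add V.toTerm W.toTerm) (.add V.toTrace W.toTrace)
  | op {Φ : FCtx} {Γ : Ctx} {φ : FEnv σ Φ} {ρ : VEnv Γ} {T U : Ty} (o : σ.Op T U) (V : Val Γ T) :
      SymEval φ ρ (.op o V.toTerm) (.op o V.toTrace)
  | letin {Φ : FCtx} {Γ : Ctx} {φ : FEnv σ Φ} {ρ : VEnv Γ} {T U : Ty} {V : Val Γ T}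
      {N : Term σ Φ (T :: Γ) U} {V' : CVal T} {C : Trace σ (T :: Γ) U} :
      Eval (k := .ty T) φ ρ V.toTerm V' →
      SymEval φ (Env.cons V' ρ) N C →
      SymEval φ ρ (.letin V.toTerm N) (.letin V.toTrace C)
  | fst {Φ : FCtx} {Γ : Ctx} {φ : FEnv σ Φ} {ρ : VEnv Γ} {T U : Ty} (V : Val Γ (.prod T U)) :
      SymEval φ ρ (.fst V.toTerm) (.fst V.toTrace)
  | snd {Φ : FCtx} {Γ : Ctx} {φ : FEnv σ Φ} {ρ : VEnv Γ} {T U : Ty} (V : Val Γ (.prod T U)) :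
      SymEval φ ρ (.snd V.toTerm) (.snd V.toTrace)
  | iteTrue {Φ : FCtx} {Γ : Ctx} {φ : FEnv σ Φ} {ρ : VEnv Γ} {T : Ty} {M N : Term σ Φ Γ T}
      {C : Trace σ Γ T} :
      SymEval φ ρ M C →
      SymEval φ ρ (.ite (.bool true) M N) C
  | iteFalse {Φ : FCtx} {Γ : Ctx} {φ : FEnv σ Φ} {ρ : VEnv Γ} {T : Ty} {M N : Term σ Φ Γ T}
      {C : Trace σ Γ T} :
      SymEval φ ρ N C →
      SymEval φ ρ (.ite (.bool false) M N) C
  | letrec {Φ : FCtx} {Γ : Ctx} {φ : FEnv σ Φ} {ρ : VEnv Γ} {T U S : Ty}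
      {M : Term σ ((T, U) :: Φ) [T] U} {N : Term σ ((T, U) :: Φ) Γ S} {C : Trace σ Γ S} :
      SymEval (FEnv.cons (.mk φ M) φ) ρ N C →
      SymEval φ ρ (.letrec M N) C
  | app {Φ Φ' : FCtx} {Γ : Ctx} {φ : FEnv σ Φ} {ρ : VEnv Γ} {T U : Ty} {f : Ix Φ (T, U)}
      {V : Val Γ T} {φ' : FEnv σ Φ'} {M : Term σ ((T, U) :: Φ') [T] U} {V' : CVal T}
      {C : Trace σ [T] U} :
      φ (T, U) f = .mk φ' M →
      Eval (k := .ty T) φ ρ V.toTerm V' →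
      SymEval (FEnv.cons (φ (T, U) f) φ') (Env.cons V' Env.nil) M C →
      SymEval φ ρ (.app f V.toTerm)
        (.letin V.toTrace (C.rename Ren.nil.lift))
  | rd {Φ : FCtx} {Γ : Ctx} {φ : FEnv σ Φ} {ρ : VEnv Γ} {T U : Ty} {N : Term σ Φ (T :: Γ) U}
      {V : Val Γ T} {W : Val Γ U} {V' : CVal T} {C : Trace σ (T :: Γ) U} :
      Eval (k := .ty T) φ ρ V.toTerm V' →
      SymEval φ (Env.cons V' ρ) N C →
      SymEval φ ρ (.rd N V.toTerm W.toTerm) (C.rev V W)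
  | ctx {Φ : FCtx} {Γ : Ctx} {φ : FEnv σ Φ} {ρ : VEnv Γ} {T U : Ty}
      {E : ECtx σ Φ Γ (.ty T) (.ty U)} {R : Term σ Φ Γ T} {C : Trace σ Γ T} {V : CVal T}
      {D : Trace σ (T :: Γ) U} :
      E.Nontrivial → IsRedex R →
      SymEval φ ρ R C →
      Eval (k := .ty T) φ ρ C.toTerm V →
      SymEval φ (Env.cons V ρ) E.plugVar D →
      SymEval φ ρ (E.plug R) (.letin C D)
  | bctx {Φ : FCtx} {Γ : Ctx} {φ : FEnv σ Φ} {ρ : VEnv Γ} {U : Ty}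
      {E : ECtx σ Φ Γ .bool (.ty U)} {R : BTerm σ Φ Γ} {b : Bool} {C : Trace σ Γ U} :
      IsRedex R →
      Eval (k := .bool) φ ρ R b →
      SymEval φ ρ (E.plug (.bool b)) C →
      SymEval φ ρ (E.plug R) C

end

/-! ## Denotational semantics -/

/-- The denotations of the two syntactic sorts. -/
abbrev KDen : Kind → Type
  | .ty T => Den T
  | .bool => Bool

/-- Semantic function environments. -/
abbrev DFCtx (Φ : FCtx) := Env (fun F : FTy => Den F.1 →. Den F.2) Φ

/-- The semantic function environment `φ[α/f]`, where `f : T → U` is a new function variable. -/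
def DFCtx.cons {Φ : FCtx} {T U : Ty} (α : Den T →. Den U) (φ : DFCtx Φ) : DFCtx ((T, U) :: Φ) :=
  Env.cons (P := fun F : FTy => Den F.1 →. Den F.2) (a := (T, U)) α φ

/-- The denotation `⟦M⟧ φ γ` of terms and of boolean terms, a partial element of `⟦T⟧`, respectively
of the set of truth values; `Part` is the type of partial elements, equality in `Part` is Kleene
equality, and `>>=` is strict application. The recursive function defined by `letrec` is `Part.fix`,
the union of the iterates of its functional, starting from the everywhere undefined function.
If `φ` consists of smooth functions, then so do the iterates and their union, which is then also the
least fixed point among the smooth partial functions. -/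
noncomputable def Expr.den {σ : Signature.{u}} : {Φ : FCtx} → {Γ : Ctx} → {k : Kind} →
    Expr σ Φ Γ k → DFCtx Φ → DCtx Γ → Part (KDen k)
  | _, _, _, .var x, _, γ => Part.some (DCtx.get x γ)
  | _, _, _, .const r, _, _ => Part.some (Den.ofReal r)
  | _, _, _, .add M N, φ, γ => (M.den φ γ).bind fun a => (N.den φ γ).bind fun b => Part.some (a + b)
  | _, _, _, .op o M, φ, γ => (M.den φ γ).bind fun a => σ.opDen o a
  | _, _, _, .letin M N, φ, γ => (M.den φ γ).bind fun a => N.den φ (DCtx.cons a γ)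
  | _, _, _, .star, _, _ => Part.some Den.star
  | _, _, _, .pair M N, φ, γ =>
    (M.den φ γ).bind fun a => (N.den φ γ).bind fun b => Part.some (Den.pair a b)
  | _, _, _, .fst M, φ, γ => (M.den φ γ).bind fun a => Part.some (Den.fst a)
  | _, _, _, .snd M, φ, γ => (M.den φ γ).bind fun a => Part.some (Den.snd a)
  | _, _, _, .ite B M N, φ, γ =>
    (B.den φ γ).bind fun b => match b with
      | true => M.den φ γ
      | false => N.den φ γ
  | _, _, _, .letrec (T := T) (U := U) M N, φ, γ =>
    N.den (DFCtx.cons (Part.fix fun (α : Den T →. Den U) (a : Den T) =>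
      M.den (DFCtx.cons α φ) (DCtx.cons a DCtx.nil)) φ) γ
  | _, _, _, .app f M, φ, γ => (M.den φ γ).bind fun a => φ _ f a
  | _, _, _, .rd N L M, φ, γ =>
    (L.den φ γ).bind fun a => (M.den φ γ).bind fun b =>
      revDeriv (fun z => N.den φ (DCtx.cons z γ)) a b
  | _, _, _, .pred p M, φ, γ => (M.den φ γ).bind fun a => σ.predDen p a
  | _, _, _, .bool b, _, _ => Part.some b

/-- The denotation `⟦C⟧ γ` of a trace term, which has no function variables. -/
noncomputable def Trace.den {σ : Signature.{u}} {Γ : Ctx} {T : Ty} (C : Trace σ Γ T)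
    (γ : DCtx Γ) : Part (Den T) :=
  (C.toTerm (Φ := [])).den Env.nil γ

/-- The denotation of a closure. -/
noncomputable def Clo.den {σ : Signature.{u}} : {T U : Ty} → Clo σ T U → (Den T →. Den U)
  | T, U, .mk φ M =>
    Part.fix fun (α : Den T →. Den U) (a : Den T) =>
      M.den (DFCtx.cons α fun F i => (φ F i).den) (DCtx.cons a DCtx.nil)

/-- The denotation `⟦φ⟧` of a function environment. -/
noncomputable def FEnv.den {σ : Signature.{u}} {Φ : FCtx} (φ : FEnv σ Φ) : DFCtx Φ :=
  fun F i => (φ F i).den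

end DiffLang

/-!
Ordinary and symbolic evaluation are treated by one simultaneous induction on derivations
(`Eval.den_eq`, `SymEval.den_eventually_eq`). For symbolic evaluation, the denotations of the term
and of its trace are shown to agree on a neighbourhood of the current environment, so that the
result can be differentiated. Four facts about the denotational semantics carry the induction.

* Smoothness (`Expr.regularAt_den`): if the function variables denote smooth partial functions with
  open domains, then so does every term, and boolean terms are locally constant. Hence a guard keeps
  its truth value, and the trace of a redex stays defined, in a neighbourhood of the environment.
* Fixed points (`Clo.den_mk_apply`): closures denote fixed points of their functionals. This follows
  from Scott continuity of the semantics (`Expr.exists_mem_den`), which holds along increasing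
  sequences of *smooth* partial functions: `revDeriv f` asks for `f` to be defined near the point,
  and a union of partial functions may satisfy this when no member does, unless domains are open.
* Differentiation (`Trace.den_rev`): `W.ℛ_x(x. C)_V` denotes the reverse-mode derivative of the
  denotation of `C`, as a Kleene equality at every environment. By smoothness, the transposed
  Jacobian is the transpose of a Fréchet derivative, and the clauses of the definition become
  instances of the chain rule (`revD_bind`, `revD_bind₂`, `revD_map₂`).
* Contexts (`ECtx.den_plugVar`): evaluation contexts bind no variables, so that a subterm in
  evaluation position can be replaced by a variable that holds its value.
-/

namespace DiffLang

universe u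

open scoped Topology ContDiff

/-! ### Partial functions that are smooth near a point -/

section Calculus

variable {E F G H : Type*} [NormedAddCommGroup E] [NormedSpace ℝ E] [NormedAddCommGroup F]
  [NormedSpace ℝ F] [NormedAddCommGroup G] [NormedSpace ℝ G] [NormedAddCommGroup H]
  [NormedSpace ℝ H]

/-- The partial function `f` is defined and smooth in a neighbourhood of `x`. -/
def SmoothAt (f : E → Part F) (x : E) : Prop :=
  ∃ g : E → F, ∀ᶠ z in 𝓝 x, f z = Part.some (g z) ∧ ContDiffAt ℝ ∞ g z

/-- The partial function `f` is defined near `x`, and it has the Fréchet derivative `f'` at `x`. -/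
def HasPDerivAt (f : E → Part F) (f' : E →L[ℝ] F) (x : E) : Prop :=
  ∃ g : E → F, (∀ᶠ z in 𝓝 x, f z = Part.some (g z)) ∧ HasFDerivAt g f' x

theorem pext_eq_of_eq_some {X κ : Type} {f : X → Part (κ → ℝ)} {x : X} {b : κ → ℝ}
    (h : f x = Part.some b) : pext f x = b := by
  simp [pext, h]

theorem SmoothPFun.smoothAt {ι κ : Type} [Fintype ι] [Fintype κ] {f : (ι → ℝ) → Part (κ → ℝ)}
    (hf : SmoothPFun f) {x : ι → ℝ} (hx : (f x).Dom) : SmoothAt f x := by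
  refine ⟨pext f, ?_⟩
  filter_upwards [hf.1.mem_nhds hx] with z hz
  refine ⟨?_, hf.2.contDiffAt (hf.1.mem_nhds hz)⟩
  obtain ⟨b, hb⟩ := Part.dom_iff_mem.1 hz
  have := Part.eq_some_iff.2 hb
  rw [pext_eq_of_eq_some this, this]

theorem SmoothAt.hasPDerivAt {f : E → Part F} {x : E} (hf : SmoothAt f x) :
    ∃ f', HasPDerivAt f f' x := by
  obtain ⟨g, hg⟩ := hf
  exact ⟨fderiv ℝ g x, g, hg.mono fun _ h => h.1,
    (hg.self_of_nhds.2.differentiableAt (by simp)).hasFDerivAt⟩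

theorem SmoothAt.congr {f g : E → Part F} {x : E} (hf : SmoothAt f x) (h : f =ᶠ[𝓝 x] g) :
    SmoothAt g x := by
  obtain ⟨f₀, hf⟩ := hf
  refine ⟨f₀, ?_⟩
  filter_upwards [hf, h] with z hz hz'
  rwa [← hz']

theorem smoothAt_some {f : E → F} (hf : ContDiff ℝ ∞ f) (x : E) :
    SmoothAt (fun z => Part.some (f z)) x :=
  ⟨f, Filter.Eventually.of_forall fun _ => ⟨rfl, hf.contDiffAt⟩⟩

theorem SmoothAt.comp {f : F → Part G} {h : E → F} {x : E} (hf : SmoothAt f (h x))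
    (hh : ContDiff ℝ ∞ h) : SmoothAt (fun z => f (h z)) x := by
  obtain ⟨f₀, hf⟩ := hf
  refine ⟨fun z => f₀ (h z), ?_⟩
  filter_upwards [hh.continuous.continuousAt.eventually hf] with z hz
  exact ⟨hz.1, hz.2.comp z hh.contDiffAt⟩

theorem SmoothAt.bind {f : E → Part F} {g : E → F → Part G} {x : E} {b : F} (hf : SmoothAt f x)
    (hb : b ∈ f x) (hg : SmoothAt (fun p : E × F => g p.1 p.2) (x, b)) :
    SmoothAt (fun z => (f z).bind (g z)) x := by
  obtain ⟨f₀, hf⟩ := hf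
  obtain ⟨g₀, hg⟩ := hg
  have hfx := hf.self_of_nhds
  obtain rfl : b = f₀ x := by simpa [hfx.1] using hb
  have ht : ContinuousAt (fun z => (z, f₀ z)) x :=
    continuousAt_id.prodMk hfx.2.continuousAt
  refine ⟨fun z => g₀ (z, f₀ z), ?_⟩
  filter_upwards [hf, ht.eventually hg] with z hz hz'
  refine ⟨by simpa [hz.1] using hz'.1, ?_⟩
  exact hz'.2.comp z (contDiffAt_id.prodMk hz.2)

theorem SmoothAt.map {f : E → Part F} {h : F → G} {x : E} (hf : SmoothAt f x)
    (hh : ContDiff ℝ ∞ h) : SmoothAt (fun z => (f z).bind fun a => Part.some (h a)) x := by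
  obtain ⟨f₀, hf⟩ := hf
  refine ⟨fun z => h (f₀ z), ?_⟩
  filter_upwards [hf] with z hz
  exact ⟨by simp [hz.1], hh.contDiffAt.comp z hz.2⟩

theorem SmoothAt.map₂ {f : E → Part F} {g : E → Part G} {h : F → G → H} {x : E} (hf : SmoothAt f x)
    (hg : SmoothAt g x) (hh : ContDiff ℝ ∞ fun p : F × G => h p.1 p.2) :
    SmoothAt (fun z => (f z).bind fun a => (g z).bind fun b => Part.some (h a b)) x := by
  obtain ⟨f₀, hf⟩ := hf
  obtain ⟨g₀, hg⟩ := hg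
  refine ⟨fun z => h (f₀ z) (g₀ z), ?_⟩
  filter_upwards [hf, hg] with z hz hz'
  refine ⟨by simp [hz.1, hz'.1], ?_⟩
  exact hh.contDiffAt.comp z (hz.2.prodMk hz'.2)

/-! ### Reverse-mode derivatives of partial functions -/

variable {ι κ μ ν : Type} [Fintype ι] [DecidableEq ι] [Fintype κ] [Fintype μ] [Fintype ν]

/-- The transpose of a linear map between powers of the reals, applied to a vector. -/
def adj (L : (ι → ℝ) →L[ℝ] (κ → ℝ)) (y : κ → ℝ) : ι → ℝ :=
  fun j => y ⬝ᵥ L (Pi.single j 1)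

theorem adj_dotProduct (L : (ι → ℝ) →L[ℝ] (κ → ℝ)) (y : κ → ℝ) (v : ι → ℝ) :
    adj L y ⬝ᵥ v = y ⬝ᵥ L v := by
  have hv : v = ∑ j, v j • (Pi.single j 1 : ι → ℝ) := by
    ext i; simp [Finset.sum_apply, Pi.single_apply]
  conv_rhs => rw [hv, map_sum, dotProduct_sum]
  refine Finset.sum_congr rfl fun j _ => ?_
  rw [map_smul, dotProduct_smul, smul_eq_mul, mul_comm]
  rfl

/-- The reverse-mode derivative `revDeriv` of a partial function, for partial functions presented as
functions with values in `Part` (the type `α →. β` is not unfolded by rewriting). -/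
noncomputable def revD (f : (ι → ℝ) → Part (κ → ℝ)) (x : ι → ℝ) (y : κ → ℝ) : Part (ι → ℝ) :=
  revDeriv f x y

theorem eventually_update {α : Type} [DecidableEq α] {p : (α → ℝ) → Prop} {x : α → ℝ}
    (h : ∀ᶠ z in 𝓝 x, p z) (j : α) : ∀ᶠ t in 𝓝 (x j), p (Function.update x j t) := by
  have hc : ContinuousAt (fun t : ℝ => Function.update x j t) (x j) :=
    (continuous_const.update j continuous_id).continuousAt
  refine hc.eventually ?_
  simpa using h

theorem revD_congr {f g : (ι → ℝ) → Part (κ → ℝ)} {x : ι → ℝ} (h : f =ᶠ[𝓝 x] g) (y : κ → ℝ) :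
    revD f x y = revD g x y := by
  have hp : ∀ i j, (fun t : ℝ => pext f (Function.update x j t) i) =ᶠ[𝓝 (x j)]
      fun t : ℝ => pext g (Function.update x j t) i := fun i j => by
    filter_upwards [eventually_update h j] with t ht
    have : pext f (Function.update x j t) = pext g (Function.update x j t) := by
      unfold pext; rw [ht]
    rw [this]
  refine Part.ext' (and_congr ?_ ?_) fun _ _ => ?_
  · exact Filter.eventually_congr (h.mono fun z hz => by rw [hz])
  · exact forall_congr' fun i => forall_congr' fun j => (hp i j).differentiableAt_iff
  · have : jacobian f x = jacobian g x := by
      ext i j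
      exact (hp i j).deriv_eq
    change (jacobian f x).transpose.mulVec y = (jacobian g x).transpose.mulVec y
    rw [this]

theorem HasPDerivAt.revD_eq {f : (ι → ℝ) → Part (κ → ℝ)} {f' : (ι → ℝ) →L[ℝ] (κ → ℝ)}
    {x : ι → ℝ} (hf : HasPDerivAt f f' x) (y : κ → ℝ) :
    revD f x y = Part.some (adj f' y) := by
  obtain ⟨g, hfg, hg⟩ := hf
  have hpg : ∀ i j, (fun t : ℝ => pext f (Function.update x j t) i) =ᶠ[𝓝 (x j)]
      fun t : ℝ => g (Function.update x j t) i := fun i j => by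
    filter_upwards [eventually_update hfg j] with t ht
    rw [pext_eq_of_eq_some ht]
  have hd : ∀ i j, HasDerivAt (fun t : ℝ => pext f (Function.update x j t) i)
      (f' (Pi.single j 1) i) (x j) := fun i j => by
    refine HasDerivAt.congr_of_eventuallyEq ?_ (hpg i j)
    have h1 : HasFDerivAt g f' (Function.update x j (x j)) := by simpa using hg
    have h2 := h1.comp_hasDerivAt (x j) (hasDerivAt_update x j (x j))
    exact hasDerivAt_pi.1 h2 i
  refine Part.eq_some_iff.2 ⟨⟨hfg.mono fun z hz => by simp [hz], fun i j =>
    (hd i j).differentiableAt⟩, ?_⟩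
  ext j
  change ∑ i, jacobian f x i j * y i = ∑ i, y i * f' (Pi.single j 1) i
  refine Finset.sum_congr rfl fun i _ => ?_
  rw [mul_comm, ← (hd i j).deriv]
  rfl

theorem revD_eq_none {f : (ι → ℝ) → Part (κ → ℝ)} {x : ι → ℝ} (h : ¬(f x).Dom) (y : κ → ℝ) :
    revD f x y = Part.none :=
  Part.eq_none_iff'.2 fun hd => h hd.1.self_of_nhds

theorem revD_some (g : (ι → ℝ) →L[ℝ] (κ → ℝ)) (x : ι → ℝ) (y : κ → ℝ) :
    revD (fun z => Part.some (g z)) x y = Part.some (adj g y) :=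
  HasPDerivAt.revD_eq ⟨g, Filter.Eventually.of_forall fun _ => rfl, g.hasFDerivAt⟩ y

theorem revD_const (b : κ → ℝ) (x : ι → ℝ) (y : κ → ℝ) :
    revD (fun _ => Part.some b) x y = Part.some 0 := by
  rw [HasPDerivAt.revD_eq (f' := 0)
    ⟨fun _ => b, Filter.Eventually.of_forall fun _ => rfl, hasFDerivAt_const b x⟩ y]
  congr 1
  ext j
  simp [adj]

theorem revD_id (x y : ι → ℝ) :
    revD (fun z => Part.some z) x y = Part.some y := by
  refine (revD_some (ContinuousLinearMap.id ℝ _) x y).trans ?_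
  congr 1
  ext j
  simp [adj]

/-- Reverse-mode derivatives depend smoothly on the point, the covector, and a parameter. -/
theorem SmoothAt.revD {f : E → (ι → ℝ) → Part (κ → ℝ)} {a : E → Part (ι → ℝ)} {b : E → Part (κ → ℝ)}
    {x : E} {a₀ : ι → ℝ} (ha : SmoothAt a x) (hb : SmoothAt b x) (ha₀ : a₀ ∈ a x)
    (hf : SmoothAt (fun p : E × (ι → ℝ) => f p.1 p.2) (x, a₀)) :
    SmoothAt (fun z => (a z).bind fun u => (b z).bind fun v => revD (f z) u v) x := by
  obtain ⟨a', ha⟩ := ha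
  obtain ⟨b', hb⟩ := hb
  obtain ⟨f', hf⟩ := hf
  have hax := ha.self_of_nhds
  obtain rfl : a₀ = a' x := by simpa [hax.1] using ha₀
  have ht : ContinuousAt (fun z => (z, a' z)) x := continuousAt_id.prodMk hax.2.continuousAt
  refine ⟨fun z => adj ((fderiv ℝ f' (z, a' z)).comp (.inr ℝ E (ι → ℝ))) (b' z), ?_⟩
  filter_upwards [ha, hb, ht.eventually hf.eventually_nhds] with z hza hzb hzf
  refine ⟨?_, ?_⟩
  · rw [hza.1, hzb.1, Part.bind_some, Part.bind_some]
    refine HasPDerivAt.revD_eq ⟨fun y => f' (z, y), ?_, ?_⟩ _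
    · have hc : ContinuousAt (fun y : ι → ℝ => (z, y)) (a' z) := by fun_prop
      exact (hc.eventually hzf).mono fun _ h => h.1
    · exact HasFDerivAt.comp (f := fun y : ι → ℝ => (z, y)) (a' z)
        (hzf.self_of_nhds.2.differentiableAt (by simp)).hasFDerivAt
        (hasFDerivAt_prodMk_right z (a' z))
  · refine contDiffAt_pi.2 fun j => ?_
    simp only [adj, dotProduct]
    refine ContDiffAt.sum fun i _ => ((contDiffAt_pi.1 hzb.2) i).mul ?_
    have hd : ContDiffAt ℝ ∞ (fun z => fderiv ℝ f' (z, a' z)) z :=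
      ContDiffAt.comp (g := fderiv ℝ f') (f := fun z => (z, a' z)) z
        (hzf.self_of_nhds.2.fderiv_right (by simp)) (contDiffAt_id.prodMk hza.2)
    exact contDiffAt_pi.1 (hd.clm_apply contDiffAt_const) i

variable [DecidableEq κ]

/-- The chain rule for a composition of partial functions, in reverse mode. -/
theorem revD_bind {f : (ι → ℝ) → Part (κ → ℝ)} {g : (κ → ℝ) → Part (μ → ℝ)} {x : ι → ℝ}
    (hf : (f x).Dom → SmoothAt f x) (hg : ∀ b ∈ f x, (g b).Dom → SmoothAt g b) (w : μ → ℝ) :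
    revD (fun z => (f z).bind g) x w =
      (f x).bind fun b => (revD g b w).bind fun v => revD f x v := by
  by_cases hx : (f x).Dom
  swap
  · rw [revD_eq_none (fun h => hx (Part.bind_dom.1 h).1), Part.eq_none_iff'.2 hx,
      Part.bind_none]
  obtain ⟨b, hb⟩ := Part.dom_iff_mem.1 hx
  have hfx := Part.eq_some_iff.2 hb
  by_cases hgb : (g b).Dom
  swap
  · rw [revD_eq_none (by simpa [hfx] using hgb), hfx, Part.bind_some, revD_eq_none hgb,
      Part.bind_none]
  obtain ⟨f', hf'⟩ := (hf hx).hasPDerivAt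
  obtain ⟨g', hg'⟩ := (hg b hb hgb).hasPDerivAt
  rw [hfx, Part.bind_some, hg'.revD_eq, Part.bind_some, hf'.revD_eq]
  obtain ⟨f₀, hf₀, hfd⟩ := hf'
  obtain ⟨g₀, hg₀, hgd⟩ := hg'
  obtain rfl : b = f₀ x := by simpa [hf₀.self_of_nhds] using hb
  rw [HasPDerivAt.revD_eq (f' := g'.comp f') ⟨g₀ ∘ f₀, ?_, hgd.comp x hfd⟩]
  · congr 1
    ext j
    exact (adj_dotProduct g' w _).symm
  · filter_upwards [hf₀, hfd.continuousAt.eventually hg₀] with z hz hz'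
    simp [hz, hz']

/-- The chain rule for `z ↦ g z (f z)`: the two arguments of `g` contribute one summand each. -/
theorem revD_bind₂ {f : (ι → ℝ) → Part (κ → ℝ)} {g : (ι → ℝ) → (κ → ℝ) → Part (μ → ℝ)} {x : ι → ℝ}
    (hf : (f x).Dom → SmoothAt f x)
    (hg : ∀ b ∈ f x, (g x b).Dom →
      SmoothAt (fun p : (ι → ℝ) × (κ → ℝ) => g p.1 p.2) (x, b)) (w : μ → ℝ) :
    revD (fun z => (f z).bind (g z)) x w =
      (f x).bind fun b => (revD (fun z => g z b) x w).bind fun u =>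
        ((revD (g x) b w).bind fun v => revD f x v).bind fun u' =>
          Part.some (u + u') := by
  by_cases hx : (f x).Dom
  swap
  · rw [revD_eq_none (fun h => hx (Part.bind_dom.1 h).1), Part.eq_none_iff'.2 hx,
      Part.bind_none]
  obtain ⟨b, hb⟩ := Part.dom_iff_mem.1 hx
  have hfx := Part.eq_some_iff.2 hb
  by_cases hgb : (g x b).Dom
  swap
  · rw [revD_eq_none (by simpa [hfx] using hgb), hfx, Part.bind_some,
      revD_eq_none (f := fun z => g z b) hgb, Part.bind_none]
  obtain ⟨f', hf'⟩ := (hf hx).hasPDerivAt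
  obtain ⟨g', hg'⟩ := (hg b hb hgb).hasPDerivAt
  obtain ⟨g₀, hg₀, hgd⟩ := hg'
  have h1 : HasPDerivAt (fun z => g z b) (g'.comp (.inl ℝ _ _)) x := by
    refine ⟨fun z => g₀ (z, b), ?_, ?_⟩
    · have hc : ContinuousAt (fun z : ι → ℝ => (z, b)) x := by fun_prop
      exact hc.eventually hg₀
    · exact HasFDerivAt.comp (f := fun z : ι → ℝ => (z, b)) x hgd (hasFDerivAt_prodMk_left x b)
  have h2 : HasPDerivAt (g x) (g'.comp (.inr ℝ _ _)) b := by
    refine ⟨fun y => g₀ (x, y), ?_, ?_⟩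
    · have hc : ContinuousAt (fun y : κ → ℝ => (x, y)) b := by fun_prop
      exact hc.eventually hg₀
    · exact HasFDerivAt.comp (f := fun y : κ → ℝ => (x, y)) b hgd (hasFDerivAt_prodMk_right x b)
  simp only [hfx, Part.bind_some, h1.revD_eq, h2.revD_eq, hf'.revD_eq]
  obtain ⟨f₀, hf₀, hfd⟩ := hf'
  obtain rfl : b = f₀ x := by simpa [hf₀.self_of_nhds] using hb
  have hp := (hasFDerivAt_id x).prodMk hfd
  rw [HasPDerivAt.revD_eq (f' := g'.comp ((ContinuousLinearMap.id ℝ _).prod f'))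
    ⟨fun z => g₀ (z, f₀ z), ?_, hgd.comp x hp⟩]
  · congr 1
    ext j
    rw [Pi.add_apply]
    change _ = w ⬝ᵥ g' (Pi.single j 1, 0) + adj (g'.comp (.inr ℝ _ _)) w ⬝ᵥ f' (Pi.single j 1)
    rw [adj_dotProduct, ← dotProduct_add]
    change w ⬝ᵥ g' (Pi.single j 1, f' (Pi.single j 1)) = w ⬝ᵥ (_ + g' (0, f' (Pi.single j 1)))
    rw [← map_add]
    simp
  · filter_upwards [hf₀, hp.continuousAt.eventually hg₀] with z hz hz'
    simpa [hz] using hz'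

/-- The reverse-mode derivative of a linear operation applied to two partial functions. -/
theorem revD_map₂ [DecidableEq μ] {f : (ι → ℝ) → Part (κ → ℝ)} {g : (ι → ℝ) → Part (μ → ℝ)}
    {x : ι → ℝ} (hf : (f x).Dom → SmoothAt f x) (hg : (g x).Dom → SmoothAt g x)
    (L : (κ → ℝ) →L[ℝ] (ν → ℝ)) (L' : (μ → ℝ) →L[ℝ] (ν → ℝ)) (w : ν → ℝ) :
    revD (fun z => (f z).bind fun a => (g z).bind fun b => Part.some (L a + L' b)) x w =
      (revD f x (adj L w)).bind fun u => (revD g x (adj L' w)).bind fun u' =>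
        Part.some (u + u') := by
  by_cases hx : (f x).Dom
  swap
  · rw [revD_eq_none (fun h => hx (Part.bind_dom.1 h).1), revD_eq_none hx, Part.bind_none]
  obtain ⟨f', hf'⟩ := (hf hx).hasPDerivAt
  rw [hf'.revD_eq, Part.bind_some]
  obtain ⟨f₀, hf₀, hfd⟩ := hf'
  have hfx := hf₀.self_of_nhds
  by_cases hgx : (g x).Dom
  swap
  · rw [revD_eq_none (by simpa [hfx] using hgx), revD_eq_none hgx, Part.bind_none]
  obtain ⟨g', hg'⟩ := (hg hgx).hasPDerivAt
  rw [hg'.revD_eq, Part.bind_some]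
  obtain ⟨g₀, hg₀, hgd⟩ := hg'
  rw [HasPDerivAt.revD_eq (f' := L.comp f' + L'.comp g')
    ⟨fun z => L (f₀ z) + L' (g₀ z), ?_,
      (L.hasFDerivAt.comp x hfd).add (L'.hasFDerivAt.comp x hgd)⟩]
  · congr 1
    ext j
    change w ⬝ᵥ (L (f' (Pi.single j 1)) + L' (g' (Pi.single j 1))) =
      adj L w ⬝ᵥ f' (Pi.single j 1) + adj L' w ⬝ᵥ g' (Pi.single j 1)
    rw [adj_dotProduct, adj_dotProduct, dotProduct_add]
  · filter_upwards [hf₀, hg₀] with z hz hz'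
    simp [hz, hz']

end Calculus

/-! ### Semantic environments -/

section Environments

variable {Γ Δ Θ : Ctx} {T U : Ty}

@[simp] theorem Den.fst_pair (a : Den T) (b : Den U) : Den.fst (Den.pair a b) = a := rfl

@[simp] theorem Den.snd_pair (a : Den T) (b : Den U) : Den.snd (Den.pair a b) = b := rfl

@[simp] theorem Den.pair_fst_snd (c : Den (.prod T U)) : Den.pair (Den.fst c) (Den.snd c) = c := by
  funext i
  rcases i with i | i <;> rfl

theorem Den.unit_ext (a b : Den .unit) : a = b := funext fun i => nomatch (i : Empty)

@[simp] theorem DCtx.get_zero (a : Den T) (γ : DCtx Γ) : DCtx.get .zero (DCtx.cons a γ) = a := rfl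

@[simp] theorem DCtx.get_succ (a : Den T) (γ : DCtx Γ) (i : Ix Γ U) :
    DCtx.get (.succ i) (DCtx.cons a γ) = DCtx.get i γ := rfl

/-- The semantic environment that assigns `γ(r(x))` to the variable `x`. -/
def DCtx.pull : {Δ : Ctx} → Ren Δ Γ → DCtx Γ → DCtx Δ
  | [], _, _ => DCtx.nil
  | _ :: _, r, γ => DCtx.cons (DCtx.get (r _ .zero) γ) (DCtx.pull (fun _ i => r _ (.succ i)) γ)

@[simp] theorem DCtx.get_pull (r : Ren Δ Γ) (γ : DCtx Γ) (i : Ix Δ T) :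
    DCtx.get i (DCtx.pull r γ) = DCtx.get (r _ i) γ := by
  induction i with
  | zero => rfl
  | succ i ih => exact ih fun _ j => r _ (.succ j)

theorem DCtx.ext {γ δ : DCtx Γ} (h : ∀ (T : Ty) (i : Ix Γ T), DCtx.get i γ = DCtx.get i δ) :
    γ = δ := by
  induction Γ with
  | nil => exact Den.unit_ext _ _
  | cons T Γ ih =>
    have h1 : Den.fst (U := Ty.ofCtx Γ) γ = Den.fst (U := Ty.ofCtx Γ) δ := h T .zero
    have h2 : Den.snd (T := T) (U := Ty.ofCtx Γ) γ = Den.snd (T := T) (U := Ty.ofCtx Γ) δ :=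
      ih fun S i => h S (.succ i)
    have h3 : ∀ δ : Den (.prod T (Ty.ofCtx Γ)), δ = Den.pair (Den.fst δ) (Den.snd δ) := fun δ =>
      (Den.pair_fst_snd δ).symm
    exact (h3 γ).trans ((congrArg₂ Den.pair h1 h2).trans (h3 δ).symm)

@[simp] theorem DCtx.pull_id (γ : DCtx Γ) : DCtx.pull (fun _ i => i) γ = γ :=
  DCtx.ext fun _ i => by simp

@[simp] theorem DCtx.pull_comp (s : Ren Δ Θ) (r : Ren Γ Δ) (γ : DCtx Θ) :
    DCtx.pull (s.comp r) γ = DCtx.pull r (DCtx.pull s γ) :=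
  DCtx.ext fun _ i => by simp [Ren.comp]

@[simp] theorem DCtx.pull_lift (r : Ren Δ Γ) (a : Den T) (γ : DCtx Γ) :
    DCtx.pull r.lift (DCtx.cons a γ) = DCtx.cons a (DCtx.pull r γ) :=
  DCtx.ext fun _ i => by cases i <;> simp [Ren.lift]

/-- The renaming that maps the most recently bound variable to `j`, and the others as `r` does. -/
def Ren.cons (j : Ix Γ T) (r : Ren Δ Γ) : Ren (T :: Δ) Γ := Env.cons (P := fun S => Ix Γ S) j r

@[simp] theorem DCtx.pull_cons (j : Ix Γ T) (r : Ren Δ Γ) (γ : DCtx Γ) :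
    DCtx.pull (Ren.cons j r) γ = DCtx.cons (DCtx.get j γ) (DCtx.pull r γ) :=
  DCtx.ext fun _ i => by
    rw [DCtx.get_pull]
    cases i
    · rfl
    · exact (DCtx.get_pull r γ _).symm

@[simp] theorem DCtx.pull_wk (a : Den T) (γ : DCtx Γ) : DCtx.pull wk (DCtx.cons a γ) = γ :=
  DCtx.ext fun _ i => by simp [wk]

@[simp] theorem DCtx.pull_wk2 {T₁ T₂ : Ty} (a₁ : Den T₁) (a₂ : Den T₂) (γ : DCtx Γ) :
    DCtx.pull wk2 (DCtx.cons a₂ (DCtx.cons a₁ γ)) = γ :=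
  DCtx.ext fun _ i => by simp [wk2]

@[simp] theorem DCtx.pull_wk3 {T₁ T₂ T₃ : Ty} (a₁ : Den T₁) (a₂ : Den T₂) (a₃ : Den T₃)
    (γ : DCtx Γ) :
    DCtx.pull wk3 (DCtx.cons a₃ (DCtx.cons a₂ (DCtx.cons a₁ γ))) = γ :=
  DCtx.ext fun _ i => by simp [wk3]

/-- The first projection, as a continuous linear map. -/
def Den.fstL (T U : Ty) : Den (.prod T U) →L[ℝ] Den T :=
  ContinuousLinearMap.pi fun i =>
    ContinuousLinearMap.proj (φ := fun _ : Coord (.prod T U) => ℝ)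
      (Sum.inl i : Coord T ⊕ Coord U)

/-- The second projection, as a continuous linear map. -/
def Den.sndL (T U : Ty) : Den (.prod T U) →L[ℝ] Den U :=
  ContinuousLinearMap.pi fun i =>
    ContinuousLinearMap.proj (φ := fun _ : Coord (.prod T U) => ℝ)
      (Sum.inr i : Coord T ⊕ Coord U)

/-- The pairing `⟦T⟧ × ⟦U⟧ → ⟦T × U⟧`, as a continuous linear map. -/
def Den.pairL (T U : Ty) : Den T × Den U →L[ℝ] Den (.prod T U) :=
  ContinuousLinearMap.pi fun i : Coord T ⊕ Coord U =>
    i.elim (fun i => (ContinuousLinearMap.proj i).comp (.fst ℝ _ _))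
      (fun i => (ContinuousLinearMap.proj i).comp (.snd ℝ _ _))

theorem Den.pairL_apply (p : Den T × Den U) : Den.pairL T U p = Den.pair p.1 p.2 := by
  funext i
  rcases i with i | i <;> rfl

theorem Den.contDiff_fst : ContDiff ℝ ∞ (Den.fst : Den (.prod T U) → Den T) :=
  (Den.fstL T U).contDiff

theorem Den.contDiff_snd : ContDiff ℝ ∞ (Den.snd : Den (.prod T U) → Den U) :=
  (Den.sndL T U).contDiff

theorem Den.contDiff_pair : ContDiff ℝ ∞ fun p : Den T × Den U => Den.pair p.1 p.2 := by
  simpa only [← Den.pairL_apply] using (Den.pairL T U).contDiff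

theorem DCtx.contDiff_cons : ContDiff ℝ ∞ fun p : Den T × DCtx Γ => DCtx.cons p.1 p.2 :=
  Den.contDiff_pair (U := Ty.ofCtx Γ)

theorem DCtx.contDiff_get (i : Ix Γ T) : ContDiff ℝ ∞ (DCtx.get i) := by
  induction i with
  | zero => exact Den.contDiff_fst
  | succ i ih => exact ih.comp Den.contDiff_snd

theorem DCtx.contDiff_pull (r : Ren Δ Γ) : ContDiff ℝ ∞ (DCtx.pull r) := by
  induction Δ with
  | nil => exact contDiff_const
  | cons T Δ ih =>
    exact DCtx.contDiff_cons.comp ((DCtx.contDiff_get _).prodMk (ih fun _ i => r _ (.succ i)))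

/-- The denotation of a value with variables. -/
def Val.eval : {T : Ty} → Val Γ T → DCtx Γ → Den T
  | _, .var x, γ => DCtx.get x γ
  | _, .const r, _ => Den.ofReal r
  | _, .star, _ => Den.star
  | _, .pair V W, γ => Den.pair (V.eval γ) (W.eval γ)

theorem Val.contDiff_eval (V : Val Γ T) : ContDiff ℝ ∞ V.eval := by
  induction V with
  | var x => exact DCtx.contDiff_get x
  | const r => exact contDiff_const
  | star => exact contDiff_const
  | pair V W hV hW => exact Den.contDiff_pair.comp (hV.prodMk hW)

@[simp] theorem Val.eval_rename (r : Ren Γ Δ) (V : Val Γ T) (γ : DCtx Δ) :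
    (V.rename r).eval γ = V.eval (DCtx.pull r γ) := by
  induction V with
  | var x => simp [Val.rename, Val.eval]
  | const c => rfl
  | star => rfl
  | pair V W hV hW => simp [Val.rename, Val.eval, hV, hW]

@[simp] theorem Val.eval_zero (γ : DCtx Γ) : (Val.zero T).eval γ = 0 := by
  induction T with
  | real => rfl
  | unit => exact Den.unit_ext _ _
  | prod T U hT hU =>
    simp only [Val.zero, Val.eval, hT, hU]
    funext i
    rcases i with i | i <;> rfl

theorem VEnv.den_cons (V : CVal T) (ρ : VEnv Γ) :
    VEnv.den (Env.cons V ρ) = DCtx.cons V.den (VEnv.den ρ) := rfl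

theorem VEnv.get_den (ρ : VEnv Γ) (i : Ix Γ T) : DCtx.get i (VEnv.den ρ) = (ρ _ i).den := by
  induction i with
  | zero => rfl
  | succ i ih => exact ih fun _ j => ρ _ (.succ j)

theorem Val.den_subst (ρ : VEnv Γ) (V : Val Γ T) : (V.subst ρ).den = V.eval (VEnv.den ρ) := by
  induction V with
  | var x => exact (VEnv.get_den ρ x).symm
  | const c => simp [Val.subst, Val.eval, Val.den]
  | star => simp [Val.subst, Val.eval, Val.den]
  | pair V W hV hW => simp [Val.subst, Val.eval, Val.den, hV, hW]

end Environments

/-! ### Denotations under renaming and in evaluation contexts -/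

section Denotations

variable {σ : Signature.{u}} {Φ Ψ : FCtx} {Γ Δ : Ctx} {T U : Ty} {k : Kind}

theorem Expr.den_rename (r : Ren Γ Δ) (M : Expr σ Φ Γ k) (φ : DFCtx Φ) (γ : DCtx Δ) :
    (M.rename r).den φ γ = M.den φ (DCtx.pull r γ) := by
  induction M generalizing Δ <;>
    simp only [Expr.rename, Expr.den, DCtx.get_pull, DCtx.pull_lift, *]

@[simp] theorem Val.den_toTerm (V : Val Γ T) (φ : DFCtx Φ) (γ : DCtx Γ) :
    (V.toTerm : Term σ Φ Γ T).den φ γ = Part.some (V.eval γ) := by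
  induction V <;> simp_all [Val.toTerm, Expr.den, Val.eval]

theorem Trace.den_toTerm_eq (C : Trace σ Γ T) (φ : DFCtx Φ) (ψ : DFCtx Ψ) (γ : DCtx Γ) :
    (C.toTerm : Term σ Φ Γ T).den φ γ = (C.toTerm : Term σ Ψ Γ T).den ψ γ := by
  induction C <;> simp_all [Trace.toTerm, Expr.den]

theorem Trace.den_toTerm (C : Trace σ Γ T) (φ : DFCtx Φ) (γ : DCtx Γ) :
    (C.toTerm : Term σ Φ Γ T).den φ γ = C.den γ :=
  C.den_toTerm_eq _ _ _

theorem Val.toTerm_toTrace (V : Val Γ T) :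
    (V.toTrace : Trace σ Γ T).toTerm (Φ := Φ) = V.toTerm := by
  induction V <;> simp_all [Val.toTerm, Val.toTrace, Trace.toTerm]

@[simp] theorem Val.den_toTrace (V : Val Γ T) (γ : DCtx Γ) :
    (V.toTrace : Trace σ Γ T).den γ = Part.some (V.eval γ) := by
  rw [Trace.den, Val.toTerm_toTrace, Val.den_toTerm]

theorem Trace.toTerm_rename (r : Ren Γ Δ) (C : Trace σ Γ T) :
    (C.rename r).toTerm (Φ := Φ) = C.toTerm.rename r := by
  induction C generalizing Δ <;> simp only [Trace.rename, Trace.toTerm, Expr.rename, *]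

@[simp] theorem Trace.den_rename (r : Ren Γ Δ) (C : Trace σ Γ T) (γ : DCtx Δ) :
    (C.rename r).den γ = C.den (DCtx.pull r γ) := by
  rw [Trace.den, Trace.toTerm_rename, Expr.den_rename, Trace.den]

theorem ECtx.rename_plug {h : Kind} (r : Ren Γ Δ) (E : ECtx σ Φ Γ h k) (M : Expr σ Φ Γ h) :
    (E.plug M).rename r = (E.rename r).plug (M.rename r) := by
  have hV : ∀ {S : Ty} (V : Val Γ S),
      (V.toTerm : Term σ Φ Γ S).rename r = (V.rename r).toTerm := fun V => by
    induction V <;> simp_all [Val.rename, Val.toTerm, Expr.rename]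
  induction E <;> simp only [ECtx.plug, ECtx.rename, Expr.rename, *]

/-- Evaluation contexts do not bind variables, so that the denotation of `E[M]` in an environment
depends only on the denotation of `M` in this environment. -/
theorem ECtx.den_plug_congr {h : Kind} (E : ECtx σ Φ Γ h k) {M N : Expr σ Φ Γ h} {φ : DFCtx Φ}
    {γ : DCtx Γ} (hMN : M.den φ γ = N.den φ γ) : (E.plug M).den φ γ = (E.plug N).den φ γ := by
  induction E <;> simp only [ECtx.plug, Expr.den, *]

/-- If `R` has the value `a`, then `E[x]` has at `γ[a/x]` the denotation that `E[R]` has at `γ`. -/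
theorem ECtx.den_plugVar (E : ECtx σ Φ Γ (.ty T) k) {R : Term σ Φ Γ T} {φ : DFCtx Φ}
    {γ : DCtx Γ} {a : Den T} (hR : R.den φ γ = Part.some a) :
    E.plugVar.den φ (DCtx.cons a γ) = (E.plug R).den φ γ := by
  have h : (R.rename wk).den φ (DCtx.cons a γ) =
      (Expr.var .zero : Term σ Φ (T :: Γ) T).den φ (DCtx.cons a γ) := by
    rw [Expr.den_rename, DCtx.pull_wk, hR]
    rfl
  rw [ECtx.plugVar, ← ECtx.den_plug_congr _ h, ← ECtx.rename_plug, Expr.den_rename, DCtx.pull_wk]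

end Denotations

/-! ### Monotonicity of the denotational semantics -/

section Monotonicity

variable {σ : Signature.{u}} {Φ : FCtx} {Γ : Ctx} {T U : Ty} {k : Kind}

/-- Extension of semantic function environments, at every function variable. -/
def DFCtx.Le (φ ψ : DFCtx Φ) : Prop :=
  ∀ (F : FTy) (i : Ix Φ F) (a : Den F.1) (b : Den F.2), b ∈ φ F i a → b ∈ ψ F i a

theorem DFCtx.Le.cons {φ ψ : DFCtx Φ} (h : φ.Le ψ) {α β : Den T → Part (Den U)}
    (hαβ : ∀ a b, b ∈ α a → b ∈ β a) : (DFCtx.cons α φ).Le (DFCtx.cons β ψ) := by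
  intro F i
  cases i with
  | zero => exact hαβ
  | succ i => exact h F i

theorem revD_mono {ι κ : Type} [Fintype ι] [DecidableEq ι] [Fintype κ]
    {f g : (ι → ℝ) → Part (κ → ℝ)} (h : ∀ a b, b ∈ f a → b ∈ g a) {x u : ι → ℝ} {y : κ → ℝ}
    (hu : u ∈ revD f x y) : u ∈ revD g x y := by
  obtain ⟨hd, -⟩ := id hu
  rwa [← revD_congr (f := f)]
  filter_upwards [hd.1] with z hz
  obtain ⟨b, hb⟩ := Part.dom_iff_mem.1 hz
  rw [Part.eq_some_iff.2 hb, Part.eq_some_iff.2 (h z b hb)]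

theorem fix_mono {α β : Type} {F G : (α → Part β) →o (α → Part β)} (h : ∀ f, F f ≤ G f) :
    Part.fix F ≤ Part.fix G := by
  have ha : ∀ i, Part.Fix.approx F i ≤ Part.Fix.approx G i := fun i => by
    induction i with
    | zero => exact le_rfl
    | succ i ih => exact (F.monotone ih).trans (h _)
  intro a b hb
  obtain ⟨i, hi⟩ := (Part.Fix.mem_iff F a b).1 hb
  exact (Part.Fix.mem_iff G a b).2 ⟨i, ha i a b hi⟩

theorem Expr.den_mono (M : Expr σ Φ Γ k) {φ ψ : DFCtx Φ} (h : φ.Le ψ) (γ : DCtx Γ)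
    {b : KDen k} (hb : b ∈ M.den φ γ) : b ∈ M.den ψ γ := by
  induction M with
  | var x => exact hb
  | const r => exact hb
  | add M N ihM ihN =>
    simp only [Expr.den, Part.mem_bind_iff] at hb ⊢
    obtain ⟨a, ha, c, hc, hb⟩ := hb
    exact ⟨a, ihM h γ ha, c, ihN h γ hc, hb⟩
  | op o M ih =>
    simp only [Expr.den, Part.mem_bind_iff] at hb ⊢
    obtain ⟨a, ha, hb⟩ := hb
    exact ⟨a, ih h γ ha, hb⟩
  | letin M N ihM ihN =>
    simp only [Expr.den, Part.mem_bind_iff] at hb ⊢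
    obtain ⟨a, ha, hb⟩ := hb
    exact ⟨a, ihM h γ ha, ihN h _ hb⟩
  | star => exact hb
  | pair M N ihM ihN =>
    simp only [Expr.den, Part.mem_bind_iff] at hb ⊢
    obtain ⟨a, ha, c, hc, hb⟩ := hb
    exact ⟨a, ihM h γ ha, c, ihN h γ hc, hb⟩
  | fst M ih =>
    simp only [Expr.den, Part.mem_bind_iff] at hb ⊢
    obtain ⟨a, ha, hb⟩ := hb
    exact ⟨a, ih h γ ha, hb⟩
  | snd M ih =>
    simp only [Expr.den, Part.mem_bind_iff] at hb ⊢
    obtain ⟨a, ha, hb⟩ := hb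
    exact ⟨a, ih h γ ha, hb⟩
  | ite B M N ihB ihM ihN =>
    simp only [Expr.den, Part.mem_bind_iff] at hb ⊢
    obtain ⟨c, hc, hb⟩ := hb
    refine ⟨c, ihB h γ hc, ?_⟩
    cases c
    · exact ihN h γ hb
    · exact ihM h γ hb
  | @letrec Φ Γ T U S M N ihM ihN =>
    let F : DFCtx Φ → (Den T → Part (Den U)) →o (Den T → Part (Den U)) := fun φ =>
      ⟨fun α a => M.den (DFCtx.cons α φ) (DCtx.cons a DCtx.nil), fun α β hαβ a b hb =>
        ihM (DFCtx.Le.cons (fun _ _ _ _ h => h) hαβ) _ hb⟩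
    have hF : Part.fix (F φ) ≤ Part.fix (F ψ) :=
      fix_mono fun α a b hb => ihM (h.cons fun _ _ h => h) _ hb
    exact ihN (h.cons hF) γ hb
  | app f M ih =>
    simp only [Expr.den, Part.mem_bind_iff] at hb ⊢
    obtain ⟨a, ha, hb⟩ := hb
    exact ⟨a, ih h γ ha, h _ f a b hb⟩
  | rd N L M ihN ihL ihM =>
    simp only [Expr.den, Part.mem_bind_iff] at hb ⊢
    obtain ⟨a, ha, c, hc, hb⟩ := hb
    exact ⟨a, ihL h γ ha, c, ihM h γ hc, revD_mono (fun z _ hz => ihN h _ hz) hb⟩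
  | pred p M ih =>
    simp only [Expr.den, Part.mem_bind_iff] at hb ⊢
    obtain ⟨a, ha, hb⟩ := hb
    exact ⟨a, ih h γ ha, hb⟩
  | bool c => exact hb

/-- The functional `α ↦ (a ↦ ⟦M⟧ (φ[α/f]) {x ↦ a})` whose least fixed point is the function that
`letrec` defines. -/
noncomputable def recHom (M : Term σ ((T, U) :: Φ) [T] U) (φ : DFCtx Φ) :
    (Den T → Part (Den U)) →o (Den T → Part (Den U)) where
  toFun α a := M.den (DFCtx.cons α φ) (DCtx.cons a DCtx.nil)
  monotone' _ _ hαβ _ _ hb := M.den_mono (DFCtx.Le.cons (fun _ _ _ _ h => h) hαβ) _ hb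

theorem Clo.den_mk (φ : FEnv σ Φ) (M : Term σ ((T, U) :: Φ) [T] U) :
    (Clo.mk φ M).den = Part.fix (recHom M φ.den) := by
  simp only [Clo.den]
  rfl

end Monotonicity

/-! ### Smoothness of the denotational semantics -/

section Smoothness

variable {σ : Signature.{u}} {Φ : FCtx} {Γ : Ctx} {T U : Ty} {k : Kind}

/-- All functions of a semantic function environment are smooth with open domains. -/
def DFCtx.Smooth (φ : DFCtx Φ) : Prop :=
  ∀ (F : FTy) (i : Ix Φ F) (a : Den F.1), (φ F i a).Dom → SmoothAt (φ F i) a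

theorem DFCtx.Smooth.cons {φ : DFCtx Φ} (hφ : φ.Smooth) {α : Den T → Part (Den U)}
    (hα : ∀ a, (α a).Dom → SmoothAt α a) : (DFCtx.cons α φ).Smooth := by
  intro F i
  cases i with
  | zero => exact hα
  | succ i => exact hφ F i

/-- Near `x`, the partial function `f` is smooth if its values are vectors, and it is constant if
its values are truth values. -/
def RegularAt {E : Type} [NormedAddCommGroup E] [NormedSpace ℝ E] :
    (k : Kind) → (E → Part (KDen k)) → E → Prop
  | .ty _, f, x => SmoothAt f x
  | .bool, p, x => ∃ b : Bool, ∀ᶠ z in 𝓝 x, p z = Part.some b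

theorem RegularAt.congr {E : Type} [NormedAddCommGroup E] [NormedSpace ℝ E]
    {f g : E → Part (KDen k)}
    {x : E} (hf : RegularAt k f x) (h : f =ᶠ[𝓝 x] g) : RegularAt k g x := by
  cases k with
  | ty T => exact SmoothAt.congr hf h
  | bool =>
    obtain ⟨b, hb⟩ := hf
    refine ⟨b, ?_⟩
    filter_upwards [hb, h] with z hz hz'
    rwa [← hz']

theorem smoothAt_fix {E F : Type} [NormedAddCommGroup E] [NormedSpace ℝ E] [NormedAddCommGroup F]
    [NormedSpace ℝ F] {H : (E → Part F) →o (E → Part F)}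
    (hH : ∀ α : E → Part F, (∀ a, (α a).Dom → SmoothAt α a) → ∀ a, (H α a).Dom → SmoothAt (H α) a) :
    (∀ (i : ℕ) (a : E), (Part.Fix.approx H i a).Dom → SmoothAt (Part.Fix.approx H i) a) ∧
      ∀ a, (Part.fix H a).Dom → SmoothAt (Part.fix H) a := by
  have hi : ∀ (i : ℕ) (a : E), (Part.Fix.approx H i a).Dom → SmoothAt (Part.Fix.approx H i) a := by
    intro i
    induction i with
    | zero => exact fun a ha => ha.elim
    | succ i ih => exact hH _ ih
  refine ⟨hi, fun a ha => ?_⟩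
  obtain ⟨b, hb⟩ := Part.dom_iff_mem.1 ha
  obtain ⟨i, hib⟩ := (Part.Fix.mem_iff H a b).1 hb
  obtain ⟨g, hg⟩ := hi i a (Part.dom_iff_mem.2 ⟨b, hib⟩)
  refine ⟨g, hg.mono fun z hz => ⟨?_, hz.2⟩⟩
  exact Part.eq_some_iff.2 (Part.Fix.approx_le_fix H i z _ (Part.eq_some_iff.1 hz.1))

/-- A term over `x : T, Γ` is smooth jointly in `γ` and in the value of `x`. -/
theorem SmoothAt.comp_cons {N : DCtx (T :: Γ) → Part (Den U)} {γ : DCtx Γ} {a : Den T}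
    (h : SmoothAt N (DCtx.cons a γ)) :
    SmoothAt (fun p : DCtx Γ × Den T => N (DCtx.cons p.2 p.1)) (γ, a) :=
  SmoothAt.comp (h := fun p : DCtx Γ × Den T => DCtx.cons p.2 p.1) h
    (DCtx.contDiff_cons.comp (contDiff_snd.prodMk contDiff_fst))

theorem RegularAt.bind {E F : Type} [NormedAddCommGroup E] [NormedSpace ℝ E]
    [NormedAddCommGroup F] [NormedSpace ℝ F] {f : E → Part F} {g : F → Part (KDen k)} {x : E}
    {b : F}
    (hf : SmoothAt f x) (hb : b ∈ f x) (hg : RegularAt k g b) :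
    RegularAt k (fun z => (f z).bind g) x := by
  cases k with
  | ty T =>
    exact SmoothAt.bind (g := fun _ => g) hf hb
      (SmoothAt.comp (h := fun p : E × F => p.2) hg contDiff_snd)
  | bool =>
    obtain ⟨c, hc⟩ := hg
    obtain ⟨f₀, hf⟩ := hf
    obtain rfl : b = f₀ x := by simpa [hf.self_of_nhds.1] using hb
    refine ⟨c, ?_⟩
    filter_upwards [hf, hf.self_of_nhds.2.continuousAt.eventually hc] with z hz hz'
    rw [hz.1, Part.bind_some, hz']

theorem Expr.regularAt_den (M : Expr σ Φ Γ k) {φ : DFCtx Φ} (hφ : φ.Smooth) {γ : DCtx Γ}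
    (hd : (M.den φ γ).Dom) : RegularAt k (M.den φ) γ := by
  induction M with
  | var x => exact smoothAt_some (DCtx.contDiff_get x) γ
  | const r => exact smoothAt_some contDiff_const γ
  | add M N ihM ihN =>
    obtain ⟨h1, h2, -⟩ := hd
    exact SmoothAt.map₂ (ihM hφ h1) (ihN hφ h2) contDiff_add
  | op o M ih =>
    obtain ⟨h1, h2⟩ := hd
    exact RegularAt.bind (k := .ty _) (ih hφ h1) (Part.get_mem h1) ((σ.opDen_smooth o).smoothAt h2)
  | letin M N ihM ihN =>
    obtain ⟨h1, h2⟩ := hd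
    exact SmoothAt.bind (g := fun z a => N.den φ (DCtx.cons a z)) (ihM hφ h1) (Part.get_mem h1)
      (SmoothAt.comp_cons (ihN hφ h2))
  | star => exact smoothAt_some contDiff_const γ
  | pair M N ihM ihN =>
    obtain ⟨h1, h2, -⟩ := hd
    exact SmoothAt.map₂ (ihM hφ h1) (ihN hφ h2) Den.contDiff_pair
  | fst M ih => exact SmoothAt.map (ih hφ hd.1) Den.contDiff_fst
  | snd M ih => exact SmoothAt.map (ih hφ hd.1) Den.contDiff_snd
  | ite B M N ihB ihM ihN =>
    obtain ⟨h1, h2⟩ := hd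
    obtain ⟨b, hb⟩ := ihB hφ h1
    have hγ := hb.self_of_nhds
    cases b with
    | true =>
      refine RegularAt.congr (k := .ty _) (f := M.den φ) (ihM hφ ?_) ?_
      · have : ((Expr.ite B M N).den φ γ).Dom := ⟨h1, h2⟩
        simpa [Expr.den, hγ] using this
      · filter_upwards [hb] with z hz
        simp [Expr.den, hz]
    | false =>
      refine RegularAt.congr (k := .ty _) (f := N.den φ) (ihN hφ ?_) ?_
      · have : ((Expr.ite B M N).den φ γ).Dom := ⟨h1, h2⟩
        simpa [Expr.den, hγ] using this
      · filter_upwards [hb] with z hz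
        simp [Expr.den, hz]
  | @letrec Φ Γ T U S M N ihM ihN =>
    refine ihN (hφ.cons (smoothAt_fix (H := recHom M φ) fun α hα a ha => ?_).2) hd
    exact SmoothAt.comp (f := M.den (DFCtx.cons α φ)) (h := fun a => DCtx.cons a DCtx.nil)
      (ihM (hφ.cons hα) ha) (DCtx.contDiff_cons.comp (contDiff_id.prodMk contDiff_const))
  | app f M ih =>
    obtain ⟨h1, h2⟩ := hd
    exact RegularAt.bind (k := .ty _) (ih hφ h1) (Part.get_mem h1) (hφ _ f _ h2)
  | rd N L M ihN ihL ihM =>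
    obtain ⟨h1, h2, h3⟩ := hd
    exact SmoothAt.revD (f := fun γ z => N.den φ (DCtx.cons z γ)) (ihL hφ h1) (ihM hφ h2)
      (Part.get_mem h1) (SmoothAt.comp_cons (ihN hφ h3.1.self_of_nhds))
  | pred p M ih =>
    obtain ⟨h1, h2⟩ := hd
    refine RegularAt.bind (k := .bool) (ih hφ h1) (Part.get_mem h1) ?_
    refine ⟨(σ.predDen p _).get h2, ?_⟩
    filter_upwards [(σ.predDen_cont p _).mem_nhds (Part.get_mem h2)] with z hz
    exact Part.eq_some_iff.2 hz
  | bool b => exact ⟨b, Filter.Eventually.of_forall fun _ => rfl⟩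

theorem recHom_smooth (M : Term σ ((T, U) :: Φ) [T] U) {φ : DFCtx Φ} (hφ : φ.Smooth)
    (α : Den T → Part (Den U)) (hα : ∀ a, (α a).Dom → SmoothAt α a) (a : Den T)
    (ha : (recHom M φ α a).Dom) : SmoothAt (recHom M φ α) a :=
  SmoothAt.comp (f := M.den (DFCtx.cons α φ)) (h := fun a => DCtx.cons a DCtx.nil)
    (M.regularAt_den (hφ.cons hα) ha) (DCtx.contDiff_cons.comp (contDiff_id.prodMk contDiff_const))

theorem Clo.smoothAt_den (c : Clo σ T U) : ∀ a, (c.den a).Dom → SmoothAt c.den a := by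
  induction c with
  | mk φ M ih =>
    exact (Clo.den_mk φ M).symm.subst
      (motive := fun f : Den _ → Part (Den _) => ∀ a, (f a).Dom → SmoothAt f a)
      (smoothAt_fix (recHom_smooth M fun F i => ih F i)).2

theorem FEnv.smooth_den (φ : FEnv σ Φ) : φ.den.Smooth := fun F i => (φ F i).smoothAt_den

end Smoothness

/-! ### Continuity of the denotational semantics, and fixed points -/

section Continuity

variable {σ : Signature.{u}} {Φ : FCtx} {Γ : Ctx} {T U : Ty} {k : Kind}

/-- The partial function `g` is the union of an increasing sequence of smooth partial functions
with open domains. -/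
structure IsSmoothSup {E F : Type} [NormedAddCommGroup E] [NormedSpace ℝ E] [NormedAddCommGroup F]
    [NormedSpace ℝ F] (f : ℕ → E → Part F) (g : E → Part F) : Prop where
  mono : ∀ n m, n ≤ m → ∀ a b, b ∈ f n a → b ∈ f m a
  mem_iff : ∀ a b, b ∈ g a ↔ ∃ n, b ∈ f n a
  smooth : ∀ n a, (f n a).Dom → SmoothAt (f n) a

/-- The semantic function environment `φ` is the union of the increasing sequence `c` of semantic
function environments that consist of smooth functions. -/
def DFCtx.IsSup (c : ℕ → DFCtx Φ) (φ : DFCtx Φ) : Prop :=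
  ∀ (F : FTy) (i : Ix Φ F), IsSmoothSup (fun n => c n F i) (φ F i)

theorem DFCtx.IsSup.le {c : ℕ → DFCtx Φ} {φ : DFCtx Φ} (h : DFCtx.IsSup c φ) (n : ℕ) :
    (c n).Le φ :=
  fun F i a b hb => ((h F i).mem_iff a b).2 ⟨n, hb⟩

theorem DFCtx.IsSup.mono {c : ℕ → DFCtx Φ} {φ : DFCtx Φ} (h : DFCtx.IsSup c φ) {n m : ℕ}
    (hnm : n ≤ m) : (c n).Le (c m) :=
  fun F i => (h F i).mono n m hnm

theorem DFCtx.IsSup.smooth {c : ℕ → DFCtx Φ} {φ : DFCtx Φ} (h : DFCtx.IsSup c φ) (n : ℕ) :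
    (c n).Smooth :=
  fun F i => (h F i).smooth n

theorem DFCtx.IsSup.cons {c : ℕ → DFCtx Φ} {φ : DFCtx Φ} (h : DFCtx.IsSup c φ)
    {α : ℕ → Den T → Part (Den U)} {β : Den T → Part (Den U)} (hα : IsSmoothSup α β) :
    DFCtx.IsSup (fun n => DFCtx.cons (α n) (c n)) (DFCtx.cons β φ) := by
  intro F i
  cases i with
  | zero => exact hα
  | succ i => exact h F i

theorem isSmoothSup_recHom {M : Term σ ((T, U) :: Φ) [T] U}
    (ih : ∀ {c : ℕ → DFCtx ((T, U) :: Φ)} {φ : DFCtx ((T, U) :: Φ)} (_ : DFCtx.IsSup c φ)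
      (γ : DCtx [T]) {b : Den U}, b ∈ M.den φ γ → ∃ n, b ∈ M.den (c n) γ)
    {c : ℕ → DFCtx Φ} {φ : DFCtx Φ} (h : DFCtx.IsSup c φ) {α : ℕ → Den T → Part (Den U)}
    {β : Den T → Part (Den U)} (hα : IsSmoothSup α β) :
    IsSmoothSup (fun n => recHom M (c n) (α n)) (recHom M φ β) where
  mono _ _ hnm _ _ hb := M.den_mono ((h.cons hα).mono hnm) _ hb
  mem_iff _ _ := ⟨fun hb => ih (h.cons hα) _ hb, fun ⟨n, hb⟩ => M.den_mono ((h.cons hα).le n) _ hb⟩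
  smooth n := recHom_smooth M (h.smooth n) _ (hα.smooth n)

/-- The recursive functions that a term defines depend continuously on the function environment, if
its denotation does. -/
theorem isSmoothSup_fix {M : Term σ ((T, U) :: Φ) [T] U}
    (ih : ∀ {c : ℕ → DFCtx ((T, U) :: Φ)} {φ : DFCtx ((T, U) :: Φ)} (_ : DFCtx.IsSup c φ)
      (γ : DCtx [T]) {b : Den U}, b ∈ M.den φ γ → ∃ n, b ∈ M.den (c n) γ)
    {c : ℕ → DFCtx Φ} {φ : DFCtx Φ} (h : DFCtx.IsSup c φ) :
    IsSmoothSup (fun n => Part.fix (recHom M (c n))) (Part.fix (recHom M φ)) := by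
  have ha : ∀ i, IsSmoothSup (fun n => Part.Fix.approx (recHom M (c n)) i)
      (Part.Fix.approx (recHom M φ) i) := by
    intro i
    induction i with
    | zero =>
      exact ⟨fun _ _ _ _ _ hb => hb, fun _ _ => ⟨fun hb => ⟨0, hb⟩, fun ⟨_, hb⟩ => hb⟩,
        fun _ _ hd => hd.elim⟩
    | succ i ihi => exact isSmoothSup_recHom ih h ihi
  refine ⟨fun n m hnm => ?_, fun a b => ?_, fun n =>
    (smoothAt_fix (recHom_smooth M (h.smooth n))).2⟩
  · exact fix_mono fun α a b hb => M.den_mono ((h.mono hnm).cons fun _ _ hb => hb) _ hb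
  · rw [Part.Fix.mem_iff]
    simp only [Part.Fix.mem_iff, (ha _).mem_iff]
    exact exists_comm

/-- The denotational semantics is Scott continuous on smooth function environments. Smoothness is
needed for reverse-mode derivatives: a union of partial functions can be defined near a point when
none of them is, unless their domains are open. -/
theorem Expr.exists_mem_den (M : Expr σ Φ Γ k) {c : ℕ → DFCtx Φ} {φ : DFCtx Φ}
    (h : DFCtx.IsSup c φ) (γ : DCtx Γ) {b : KDen k} (hb : b ∈ M.den φ γ) :
    ∃ n, b ∈ M.den (c n) γ := by
  induction M with
  | var x => exact ⟨0, hb⟩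
  | const r => exact ⟨0, hb⟩
  | add M N ihM ihN =>
    simp only [Expr.den, Part.mem_bind_iff] at hb ⊢
    obtain ⟨a, ha, d, hd, hb⟩ := hb
    obtain ⟨n, hn⟩ := ihM h γ ha
    obtain ⟨m, hm⟩ := ihN h γ hd
    exact ⟨max n m, a, M.den_mono (h.mono (le_max_left n m)) γ hn, d,
      N.den_mono (h.mono (le_max_right n m)) γ hm, hb⟩
  | op o M ih =>
    simp only [Expr.den, Part.mem_bind_iff] at hb ⊢
    obtain ⟨a, ha, hb⟩ := hb
    obtain ⟨n, hn⟩ := ih h γ ha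
    exact ⟨n, a, hn, hb⟩
  | letin M N ihM ihN =>
    simp only [Expr.den, Part.mem_bind_iff] at hb ⊢
    obtain ⟨a, ha, hb⟩ := hb
    obtain ⟨n, hn⟩ := ihM h γ ha
    obtain ⟨m, hm⟩ := ihN h _ hb
    exact ⟨max n m, a, M.den_mono (h.mono (le_max_left n m)) γ hn,
      N.den_mono (h.mono (le_max_right n m)) _ hm⟩
  | star => exact ⟨0, hb⟩
  | pair M N ihM ihN =>
    simp only [Expr.den, Part.mem_bind_iff] at hb ⊢
    obtain ⟨a, ha, d, hd, hb⟩ := hb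
    obtain ⟨n, hn⟩ := ihM h γ ha
    obtain ⟨m, hm⟩ := ihN h γ hd
    exact ⟨max n m, a, M.den_mono (h.mono (le_max_left n m)) γ hn, d,
      N.den_mono (h.mono (le_max_right n m)) γ hm, hb⟩
  | fst M ih =>
    simp only [Expr.den, Part.mem_bind_iff] at hb ⊢
    obtain ⟨a, ha, hb⟩ := hb
    obtain ⟨n, hn⟩ := ih h γ ha
    exact ⟨n, a, hn, hb⟩
  | snd M ih =>
    simp only [Expr.den, Part.mem_bind_iff] at hb ⊢
    obtain ⟨a, ha, hb⟩ := hb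
    obtain ⟨n, hn⟩ := ih h γ ha
    exact ⟨n, a, hn, hb⟩
  | ite B M N ihB ihM ihN =>
    simp only [Expr.den, Part.mem_bind_iff] at hb ⊢
    obtain ⟨d, hd, hb⟩ := hb
    obtain ⟨n, hn⟩ := ihB h γ hd
    cases d with
    | true =>
      obtain ⟨m, hm⟩ := ihM h γ hb
      exact ⟨max n m, true, B.den_mono (h.mono (le_max_left n m)) γ hn,
        M.den_mono (h.mono (le_max_right n m)) γ hm⟩
    | false =>
      obtain ⟨m, hm⟩ := ihN h γ hb
      exact ⟨max n m, false, B.den_mono (h.mono (le_max_left n m)) γ hn,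
        N.den_mono (h.mono (le_max_right n m)) γ hm⟩
  | letrec M N ihM ihN => exact ihN (h.cons (isSmoothSup_fix ihM h)) γ hb
  | app f M ih =>
    simp only [Expr.den, Part.mem_bind_iff] at hb ⊢
    obtain ⟨a, ha, hb⟩ := hb
    obtain ⟨n, hn⟩ := ih h γ ha
    obtain ⟨m, hm⟩ := ((h _ f).mem_iff a b).1 hb
    exact ⟨max n m, a, M.den_mono (h.mono (le_max_left n m)) γ hn,
      h.mono (le_max_right n m) _ f a b hm⟩
  | rd N L M ihN ihL ihM =>
    simp only [Expr.den, Part.mem_bind_iff] at hb ⊢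
    obtain ⟨a, ha, d, hd, hb⟩ := hb
    obtain ⟨n, hn⟩ := ihL h γ ha
    obtain ⟨m, hm⟩ := ihM h γ hd
    obtain ⟨hdom, -⟩ := id hb
    obtain ⟨y, hy⟩ := Part.dom_iff_mem.1 hdom.1.self_of_nhds
    obtain ⟨l, hl⟩ := ihN h _ hy
    refine ⟨max (max n m) l, a, L.den_mono (h.mono (by omega)) γ hn, d,
      M.den_mono (h.mono (by omega)) γ hm, ?_⟩
    -- the `l`-th approximation is defined at `a`, hence, being smooth, near `a`
    obtain ⟨g, hg⟩ := SmoothAt.comp (h := fun z => DCtx.cons z γ)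
      (N.regularAt_den (h.smooth l) (Part.dom_iff_mem.2 ⟨y, hl⟩))
      (DCtx.contDiff_cons.comp (contDiff_id.prodMk contDiff_const))
    have he : (fun z => N.den φ (DCtx.cons z γ)) =ᶠ[𝓝 a]
        fun z => N.den (c l) (DCtx.cons z γ) := by
      filter_upwards [hg] with z hz
      rw [hz.1, Part.eq_some_iff]
      exact N.den_mono (h.le l) _ (Part.eq_some_iff.1 hz.1)
    have hb' := (revD_congr he d).subst (motive := fun p => b ∈ p) hb
    exact revD_mono (fun z _ hz => N.den_mono (h.mono (le_max_right _ l)) _ hz) hb'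
  | pred p M ih =>
    simp only [Expr.den, Part.mem_bind_iff] at hb ⊢
    obtain ⟨a, ha, hb⟩ := hb
    obtain ⟨n, hn⟩ := ih h γ ha
    exact ⟨n, a, hn, hb⟩
  | bool c => exact ⟨0, hb⟩

/-- The denotation of a closure is a fixed point of its functional. -/
theorem Clo.den_mk_apply (φ : FEnv σ Φ) (M : Term σ ((T, U) :: Φ) [T] U) (a : Den T) :
    (Clo.mk φ M).den a =
      M.den (DFCtx.cons (Clo.mk φ M).den φ.den) (DCtx.cons a DCtx.nil) := by
  rw [Clo.den_mk]
  have hs := smoothAt_fix (recHom_smooth M φ.smooth_den)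
  have hsup : DFCtx.IsSup
      (fun n => DFCtx.cons (Part.Fix.approx (recHom M φ.den) n) φ.den)
      (DFCtx.cons (Part.fix (recHom M φ.den)) φ.den) := by
    refine DFCtx.IsSup.cons (c := fun _ => φ.den) (fun F i => ?_) ?_
    · exact ⟨fun _ _ _ _ _ hb => hb, fun _ _ => ⟨fun hb => ⟨0, hb⟩, fun ⟨_, hb⟩ => hb⟩,
        fun _ => φ.smooth_den F i⟩
    · exact ⟨fun _ _ hnm => Part.Fix.approx_mono _ hnm, Part.Fix.mem_iff _, hs.1⟩
  refine Part.ext fun b => ⟨fun hb => ?_, fun hb => ?_⟩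
  · obtain ⟨i, hi⟩ := (Part.Fix.mem_iff (recHom M φ.den) a b).1 hb
    have hi' := Part.Fix.approx_mono' (recHom M φ.den) a b hi
    exact M.den_mono (hsup.le i) _ hi'
  · obtain ⟨n, hn⟩ := M.exists_mem_den hsup _ hb
    exact (Part.Fix.mem_iff (recHom M φ.den) a b).2 ⟨n + 1, hn⟩

end Continuity

/-! ### Correctness of symbolic differentiation -/

section Differentiation

variable {σ : Signature.{u}} {Γ Δ : Ctx} {T U S : Ty}

theorem Trace.smoothAt_den (C : Trace σ Γ T) {γ : DCtx Γ} (h : (C.den γ).Dom) :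
    SmoothAt C.den γ :=
  C.toTerm.regularAt_den (φ := Env.nil) (fun _ i => by cases i) h

theorem Trace.smoothAt_den_pull (C : Trace σ Δ U) (r : Ren Δ (T :: Γ)) (γ : DCtx Γ) (x : Den T)
    (h : (C.den (DCtx.pull r (DCtx.cons x γ))).Dom) :
    SmoothAt (fun z => C.den (DCtx.pull r (DCtx.cons z γ))) x :=
  SmoothAt.comp (h := fun z => DCtx.pull r (DCtx.cons z γ)) (C.smoothAt_den h)
    ((DCtx.contDiff_pull r).comp (DCtx.contDiff_cons.comp (contDiff_id.prodMk contDiff_const)))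

theorem Trace.den_add (C D : Trace σ Γ .real) (γ : DCtx Γ) : (Trace.add C D).den γ =
    (C.den γ).bind fun a => (D.den γ).bind fun b => Part.some (a + b) := rfl

theorem Trace.den_op (o : σ.Op T U) (C : Trace σ Γ T) (γ : DCtx Γ) :
    (Trace.op o C).den γ = (C.den γ).bind fun a => σ.opDen o a := rfl

theorem Trace.den_letin (C : Trace σ Γ T) (D : Trace σ (T :: Γ) U) (γ : DCtx Γ) :
    (Trace.letin C D).den γ = (C.den γ).bind fun a => D.den (DCtx.cons a γ) := rfl

theorem Trace.den_pair (C : Trace σ Γ T) (D : Trace σ Γ U) (γ : DCtx Γ) : (Trace.pair C D).den γ =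
    (C.den γ).bind fun a => (D.den γ).bind fun b => Part.some (Den.pair a b) := rfl

theorem Trace.den_fst (C : Trace σ Γ (.prod T U)) (γ : DCtx Γ) :
    (Trace.fst C).den γ = (C.den γ).bind fun a => Part.some (Den.fst a) := rfl

theorem Trace.den_snd (C : Trace σ Γ (.prod T U)) (γ : DCtx Γ) :
    (Trace.snd C).den γ = (C.den γ).bind fun a => Part.some (Den.snd a) := rfl

theorem Trace.den_var (x : Ix Γ T) (γ : DCtx Γ) :
    (Trace.var x : Trace σ Γ T).den γ = Part.some (DCtx.get x γ) := rfl

theorem Trace.den_letPair (C : Trace σ Γ (.prod T U))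
    (D : Trace σ (U :: T :: Ty.prod T U :: Γ) S) (γ : DCtx Γ) :
    (Trace.letPair C D).den γ = (C.den γ).bind fun c =>
      D.den (DCtx.cons (Den.snd c) (DCtx.cons (Den.fst c) (DCtx.cons c γ))) := by
  simp only [letPair, den_letin, den_fst, den_snd, den_var, Part.bind_some, DCtx.get_zero,
    DCtx.get_succ]

theorem Trace.den_addT (C D : Trace σ Γ T) (γ : DCtx Γ) : (Trace.addT T C D).den γ =
    (C.den γ).bind fun a => (D.den γ).bind fun b => Part.some (a + b) := by
  induction T generalizing Γ with
  | real => rfl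
  | unit =>
    simp only [addT, den_letin, den_rename, DCtx.pull_wk]
    congr! 5
    exact congrArg Part.some (Den.unit_ext _ _)
  | prod T U ihT ihU =>
    simp only [addT, den_letPair, den_pair, ihT, ihU, den_var, den_rename, DCtx.pull_wk3,
      Part.bind_some, DCtx.get_zero, DCtx.get_succ]
    congr! 5 with a b
    funext i
    rcases i with i | i <;> rfl

theorem Den.dotProduct_prod (a b : Den (.prod T U)) :
    a ⬝ᵥ b = Den.fst a ⬝ᵥ Den.fst b + Den.snd a ⬝ᵥ Den.snd b :=
  Fintype.sum_sum_type fun i : Coord T ⊕ Coord U => a i * b i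

theorem adj_eq {ι κ : Type} [Fintype ι] [DecidableEq ι] [Fintype κ]
    {L : (ι → ℝ) →L[ℝ] (κ → ℝ)} {w : κ → ℝ} {v : ι → ℝ} (h : ∀ x, v ⬝ᵥ x = w ⬝ᵥ L x) :
    adj L w = v := by
  ext j
  rw [adj, ← h, dotProduct_single_one]

theorem revD_fst (x : Den (.prod T U)) (w : Den T) :
    revD (fun c : Den (.prod T U) => Part.some (Den.fst c)) x w =
      Part.some (Den.pair w (0 : Den U)) := by
  refine (revD_some (Den.fstL T U) x w).trans (congrArg Part.some (adj_eq fun c => ?_))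
  rw [Den.dotProduct_prod, Den.fst_pair, Den.snd_pair, zero_dotProduct, add_zero]
  rfl

theorem revD_snd (x : Den (.prod T U)) (w : Den U) :
    revD (fun c : Den (.prod T U) => Part.some (Den.snd c)) x w =
      Part.some (Den.pair (0 : Den T) w) := by
  refine (revD_some (Den.sndL T U) x w).trans (congrArg Part.some (adj_eq fun c => ?_))
  rw [Den.dotProduct_prod, Den.fst_pair, Den.snd_pair, zero_dotProduct, zero_add]
  rfl

theorem revD_add {ι : Type} [Fintype ι] [DecidableEq ι] {f g : (ι → ℝ) → Part (Den T)} {x : ι → ℝ}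
    (hf : (f x).Dom → SmoothAt f x) (hg : (g x).Dom → SmoothAt g x) (w : Den T) :
    revD (fun z => (f z).bind fun a => (g z).bind fun b => Part.some (a + b)) x w =
      (revD f x w).bind fun u => (revD g x w).bind fun u' => Part.some (u + u') := by
  have h := revD_map₂ hf hg (.id ℝ _) (.id ℝ _) w
  rwa [adj_eq (L := .id ℝ (Den T)) (w := w) (v := w) fun _ => rfl] at h

theorem revD_pair {ι : Type} [Fintype ι] [DecidableEq ι] {f : (ι → ℝ) → Part (Den T)}
    {g : (ι → ℝ) → Part (Den U)} {x : ι → ℝ}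
    (hf : (f x).Dom → SmoothAt f x) (hg : (g x).Dom → SmoothAt g x) (w : Den (.prod T U)) :
    revD (fun z => (f z).bind fun a => (g z).bind fun b => Part.some (Den.pair a b)) x w =
      (revD f x (Den.fst w)).bind fun u => (revD g x (Den.snd w)).bind fun u' =>
        Part.some (u + u') := by
  have h := revD_map₂ hf hg ((Den.pairL T U).comp (.inl ℝ _ _))
    ((Den.pairL T U).comp (.inr ℝ _ _)) w
  have h1 : adj ((Den.pairL T U).comp (.inl ℝ _ _)) w = Den.fst w := adj_eq fun a => by
    change _ = w ⬝ᵥ Den.pairL T U (a, 0)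
    rw [Den.pairL_apply, Den.dotProduct_prod]
    simp
  have h2 : adj ((Den.pairL T U).comp (.inr ℝ _ _)) w = Den.snd w := adj_eq fun b => by
    change _ = w ⬝ᵥ Den.pairL T U (0, b)
    rw [Den.pairL_apply, Den.dotProduct_prod]
    simp
  rw [h1, h2] at h
  refine Eq.trans ?_ h
  congr! 7 with z a b
  change _ = Den.pairL T U (a, 0) + Den.pairL T U (0, b)
  rw [← map_add, Prod.mk_add_mk, add_zero, zero_add, Den.pairL_apply]

/-- The defining equation for `let`, with `Ren.cons` in place of the extension of environments, so
that the two renamings have the form that the rewriting lemmas expect. -/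
theorem Trace.revAux_letin {R : Ty} (D : Trace σ Δ S) (E : Trace σ (S :: Δ) U) (r : Ren Δ (R :: Γ))
    (V : Val Γ R) (W : Val Γ U) : (Trace.letin D E).revAux r V W =
      .letin V.toTrace (.letin (D.rename r) (.addT R
        (E.revAux (Ren.cons (.succ .zero) (wk2.lift.comp r)) (V.rename wk2) (W.rename wk2))
        (.letin (E.revAux (Ren.cons .zero (wk2.comp r)) (.var .zero) (W.rename wk2))
          (D.revAux (wk3.lift.comp r) (V.rename wk3) (.var .zero))))) := rfl

/-- Symbolic differentiation computes the reverse-mode derivative of the denotation, as a Kleene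
equality at every environment `γ`. -/
theorem Trace.den_revAux (C : Trace σ Δ U) (r : Ren Δ (T :: Γ)) (V : Val Γ T) (W : Val Γ U)
    (γ : DCtx Γ) : (C.revAux r V W).den γ =
      revD (fun z => C.den (DCtx.pull r (DCtx.cons z γ))) (V.eval γ) (W.eval γ) := by
  induction C generalizing Γ T with
  | var y =>
    simp only [revAux, den_var, DCtx.get_pull]
    generalize r _ y = i
    cases i with
    | zero => simp only [DCtx.get_zero, revD_id, Val.den_toTrace]
    | succ i => simp only [DCtx.get_succ, revD_const, Val.den_toTrace, Val.eval_zero]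
  | const c =>
    rw [revAux, Val.den_toTrace, Val.eval_zero]
    exact (revD_const _ _ _).symm
  | star =>
    rw [revAux, Val.den_toTrace, Val.eval_zero]
    exact (revD_const _ _ _).symm
  | add D E ihD ihE =>
    simp only [revAux, den_addT, ihD, ihE, den_add]
    exact (revD_add (D.smoothAt_den_pull r γ _) (E.smoothAt_den_pull r γ _) _).symm
  | op o D ih =>
    simp only [revAux, den_letin, den_op, den_pair, ih, Val.den_toTrace, Part.bind_some,
      Part.bind_assoc, den_rename, Val.eval_rename, DCtx.pull_wk, DCtx.pull_wk2, DCtx.pull_comp,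
      DCtx.pull_lift, Val.eval, DCtx.get_zero, σ.opDen_rev]
    exact (revD_bind (f := fun z => D.den (DCtx.pull r (DCtx.cons z γ))) (g := σ.opDen o)
      (D.smoothAt_den_pull r γ _)
      (fun _ _ hb => (σ.opDen_smooth o).smoothAt hb) _).symm
  | letin D E ihD ihE =>
    simp only [revAux_letin, den_letin, den_addT, ihD, ihE, Val.den_toTrace, Part.bind_some,
      den_rename, Val.eval_rename, DCtx.pull_wk2, DCtx.pull_wk3, DCtx.pull_comp,
      DCtx.pull_lift, DCtx.pull_cons, Val.eval, DCtx.get_zero, DCtx.get_succ]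
    refine (revD_bind₂ (f := fun z => D.den (DCtx.pull r (DCtx.cons z γ)))
      (g := fun z y => E.den (DCtx.cons y (DCtx.pull r (DCtx.cons z γ))))
      (D.smoothAt_den_pull r γ _) (fun b _ hb => ?_) _).symm
    exact SmoothAt.comp
      (h := fun p : Den _ × Den _ => DCtx.cons p.2 (DCtx.pull r (DCtx.cons p.1 γ)))
      (E.smoothAt_den hb) (DCtx.contDiff_cons.comp (contDiff_snd.prodMk
        ((DCtx.contDiff_pull r).comp (DCtx.contDiff_cons.comp
          (contDiff_fst.prodMk contDiff_const)))))
  | pair D E ihD ihE =>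
    simp only [revAux, den_letPair, den_addT, ihD, ihE, den_pair, Val.den_toTrace, Part.bind_some,
      Val.eval_rename, DCtx.pull_wk3, DCtx.pull_comp, DCtx.pull_lift, Val.eval, DCtx.get_zero,
      DCtx.get_succ]
    exact (revD_pair (D.smoothAt_den_pull r γ _) (E.smoothAt_den_pull r γ _) _).symm
  | fst D ih =>
    simp only [revAux, den_letin, den_fst, ih, Val.den_toTrace, Part.bind_some, den_rename,
      Val.eval_rename, DCtx.pull_wk2, DCtx.pull_comp, DCtx.pull_lift, Val.eval, Val.eval_zero]
    refine ((revD_bind (f := fun z => D.den (DCtx.pull r (DCtx.cons z γ)))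
      (g := fun c => Part.some (Den.fst c)) (D.smoothAt_den_pull r γ _)
      (fun _ _ _ => smoothAt_some Den.contDiff_fst _) _).trans ?_).symm
    simp only [revD_fst, Part.bind_some]
  | snd D ih =>
    simp only [revAux, den_letin, den_snd, ih, Val.den_toTrace, Part.bind_some, den_rename,
      Val.eval_rename, DCtx.pull_wk2, DCtx.pull_comp, DCtx.pull_lift, Val.eval, Val.eval_zero]
    refine ((revD_bind (f := fun z => D.den (DCtx.pull r (DCtx.cons z γ)))
      (g := fun c => Part.some (Den.snd c)) (D.smoothAt_den_pull r γ _)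
      (fun _ _ _ => smoothAt_some Den.contDiff_snd _) _).trans ?_).symm
    simp only [revD_snd, Part.bind_some]

theorem Trace.den_rev (C : Trace σ (T :: Γ) U) (V : Val Γ T) (W : Val Γ U) (γ : DCtx Γ) :
    (C.rev V W).den γ = revD (fun z => C.den (DCtx.cons z γ)) (V.eval γ) (W.eval γ) := by
  simp only [rev, den_revAux, DCtx.pull_id]

end Differentiation

/-! ### Correctness of evaluation -/

section Evaluation

variable {σ : Signature.{u}} {Φ : FCtx} {Γ : Ctx} {T U : Ty}

/-- The denotation of a result of evaluation: a closed value or a truth value. -/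
def Res.den : {k : Kind} → Res k → KDen k
  | .ty _, V => Val.den V
  | .bool, b => b

theorem Val.eval_eq_of_eval {φ : FEnv σ Φ} {V : Val Γ T} {γ : DCtx Γ} {V' : CVal T}
    (h : (V.toTerm : Term σ Φ Γ T).den φ.den γ = Part.some V'.den) : V.eval γ = V'.den := by
  rw [Val.den_toTerm] at h
  exact Part.some_injective h

theorem FEnv.den_cons (c : Clo σ T U) (φ : FEnv σ Φ) :
    (FEnv.cons c φ).den = DFCtx.cons c.den φ.den := by
  funext F i
  cases i <;> rfl

theorem eventually_cons {p : DCtx (T :: Γ) → Prop} {f : DCtx Γ → Den T} {γ : DCtx Γ}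
    (hf : ContinuousAt f γ) (h : ∀ᶠ δ in 𝓝 (DCtx.cons (f γ) γ), p δ) :
    ∀ᶠ δ in 𝓝 γ, p (DCtx.cons (f δ) δ) := by
  have hc : ContinuousAt (fun δ => DCtx.cons (f δ) δ) γ :=
    (DCtx.contDiff_cons.continuous.continuousAt (x := (f γ, γ))).comp (f := fun δ => (f δ, δ))
      (hf.prodMk continuousAt_id)
  exact hc.eventually h

mutual

/-- Ordinary evaluation agrees with the denotational semantics. -/
theorem Eval.den_eq : ∀ {Φ : FCtx} {Γ : Ctx} {k : Kind} {φ : FEnv σ Φ} {ρ : VEnv Γ}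
    {M : Expr σ Φ Γ k} {V : Res k}, Eval φ ρ M V → M.den φ.den (VEnv.den ρ) = Part.some V.den
  | _, _, _, _, _, _, _, .val V => by rw [Val.den_toTerm, ← Val.den_subst]; rfl
  | _, _, _, _, _, _, _, .bool b => rfl
  | _, _, _, _, _, _, _, @Eval.add _ _ _ _ _ V W r s hV hW => by
    simp only [Expr.den, hV.den_eq, hW.den_eq, Part.bind_some]
    rfl
  | _, _, _, _, _, _, _, .op hV hW => by
    simp only [Expr.den, hV.den_eq, Part.bind_some]
    exact (σ.opDen_ev _ _).trans (by rw [Part.eq_some_iff.2 hW, Part.map_some]; rfl)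
  | _, _, _, _, _, _, _, .letin hV hN => by
    simp only [Expr.den, hV.den_eq, Part.bind_some]
    exact hN.den_eq
  | _, _, _, _, _, _, _, .fst hV => by
    simp only [Expr.den, hV.den_eq, Part.bind_some]
    rfl
  | _, _, _, _, _, _, _, .snd hV => by
    simp only [Expr.den, hV.den_eq, Part.bind_some]
    rfl
  | _, _, _, _, _, _, _, .iteTrue hM => by
    simp only [Expr.den, Part.bind_some]
    exact hM.den_eq
  | _, _, _, _, _, _, _, .iteFalse hN => by
    simp only [Expr.den, Part.bind_some]
    exact hN.den_eq
  | _, _, _, _, _, _, _, .letrec hN => by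
    have h := hN.den_eq
    rw [FEnv.den_cons, Clo.den_mk] at h
    exact h
  | _, _, _, φ, ρ, _, _, @Eval.app _ _ _ _ _ _ _ _ f _ _ M _ _ hf hV hM => by
    have h := hM.den_eq
    rw [FEnv.den_cons, VEnv.den_cons, hf] at h
    simp only [Expr.den, hV.den_eq, Part.bind_some]
    refine Eq.trans ?_ h
    change (φ _ f).den _ = _
    rw [hf]
    exact Clo.den_mk_apply _ _ _
  | _, _, _, φ, ρ, _, _, .rd hC hX => by
    rw [hC.den_eventually_eq.self_of_nhds, ← Trace.den_toTerm _ φ.den]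
    exact hX.den_eq
  | _, _, _, _, _, _, _, .pred hV hb => by
    simp only [Expr.den, hV.den_eq, Part.bind_some]
    exact (σ.predDen_bev _ _).trans (Part.eq_some_iff.2 hb)
  | _, _, _, _, _, _, _, .ctx _ _ hR hE => by
    rw [← ECtx.den_plugVar _ hR.den_eq]
    exact hE.den_eq
  | _, _, _, _, _, _, _, .bctx _ hR hE => by
    rw [← hE.den_eq]
    exact ECtx.den_plug_congr _ hR.den_eq

/-- A term and its symbolic trace have the same denotation near the environment in which the term
was evaluated. Equality at that environment alone would not carry over to derivatives. -/
theorem SymEval.den_eventually_eq : ∀ {Φ : FCtx} {Γ : Ctx} {T : Ty} {φ : FEnv σ Φ} {ρ : VEnv Γ}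
    {M : Term σ Φ Γ T} {C : Trace σ Γ T}, SymEval φ ρ M C →
      ∀ᶠ γ in 𝓝 (VEnv.den ρ), M.den φ.den γ = C.den γ
  | _, _, _, _, _, _, _, .val V =>
    .of_forall fun γ => by rw [Val.den_toTerm, Val.den_toTrace]
  | _, _, _, _, _, _, _, .add V W =>
    .of_forall fun γ => by
      simp only [Expr.den, Trace.den_add, Val.den_toTerm, Val.den_toTrace]
  | _, _, _, _, _, _, _, .op o V =>
    .of_forall fun γ => by
      simp only [Expr.den, Trace.den_op, Val.den_toTerm, Val.den_toTrace]
  | _, _, _, _, _, _, _, .fst V =>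
    .of_forall fun γ => by
      simp only [Expr.den, Trace.den_fst, Val.den_toTerm, Val.den_toTrace]
  | _, _, _, _, _, _, _, .snd V =>
    .of_forall fun γ => by
      simp only [Expr.den, Trace.den_snd, Val.den_toTerm, Val.den_toTrace]
  | _, _, _, _, _, _, _,
    @SymEval.letin _ _ _ _ _ _ _ V N _ C hV hN => by
    have h := hN.den_eventually_eq
    rw [VEnv.den_cons, ← Val.eval_eq_of_eval hV.den_eq] at h
    filter_upwards [eventually_cons V.contDiff_eval.continuous.continuousAt h] with γ hγ
    simpa only [Expr.den, Trace.den_letin, Val.den_toTerm, Val.den_toTrace, Part.bind_some] using hγ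
  | _, _, _, _, _, _, _, .iteTrue hM => by
    filter_upwards [hM.den_eventually_eq] with γ hγ
    simpa only [Expr.den, Part.bind_some] using hγ
  | _, _, _, _, _, _, _, .iteFalse hN => by
    filter_upwards [hN.den_eventually_eq] with γ hγ
    simpa only [Expr.den, Part.bind_some] using hγ
  | _, _, _, _, _, _, _, .letrec hN => by
    have h := hN.den_eventually_eq
    rw [FEnv.den_cons, Clo.den_mk] at h
    exact h
  | _, _, _, φ, ρ, _, _,
    @SymEval.app _ _ _ _ _ _ _ _ f V _ M _ C hf hV hM => by
    have h := hM.den_eventually_eq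
    rw [FEnv.den_cons, VEnv.den_cons, hf, ← Val.eval_eq_of_eval hV.den_eq] at h
    have hc : ContinuousAt (fun γ => DCtx.cons (V.eval γ) DCtx.nil) (VEnv.den ρ) :=
      (DCtx.contDiff_cons.comp (V.contDiff_eval.prodMk contDiff_const)).continuous.continuousAt
    filter_upwards [hc.eventually h] with γ hγ
    simp only [Expr.den, Trace.den_letin, Val.den_toTerm, Val.den_toTrace, Part.bind_some,
      Trace.den_rename, DCtx.pull_lift]
    refine Eq.trans ?_ hγ
    change (φ _ f).den _ = _
    rw [hf]
    exact Clo.den_mk_apply _ _ _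
  | _, _, _, _, _, _, _,
    @SymEval.rd _ _ _ _ _ _ _ N V W _ C hV hN => by
    have h := hN.den_eventually_eq
    rw [VEnv.den_cons, ← Val.eval_eq_of_eval hV.den_eq] at h
    filter_upwards [eventually_cons V.contDiff_eval.continuous.continuousAt h.eventually_nhds]
      with γ hγ
    simp only [Expr.den, Trace.den_rev, Val.den_toTerm, Part.bind_some]
    have hc : ContinuousAt (fun z => DCtx.cons z γ) (V.eval γ) :=
      (DCtx.contDiff_cons.comp (contDiff_id.prodMk contDiff_const)).continuous.continuousAt
    exact revD_congr (hc.eventually hγ) _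
  | _, _, _, φ, ρ, _, _,
    @SymEval.ctx _ _ _ _ _ _ _ E R C V D _ _ hR hC hE => by
    have hCV : C.den (VEnv.den ρ) = Part.some V.den := by
      rw [← Trace.den_toTerm C φ.den]
      exact hC.den_eq
    obtain ⟨g, hg⟩ := C.smoothAt_den (γ := VEnv.den ρ) (by rw [hCV]; trivial)
    have hgV : g (VEnv.den ρ) = V.den := Part.some_injective (hg.self_of_nhds.1.symm.trans hCV)
    have h := hE.den_eventually_eq
    rw [VEnv.den_cons, ← hgV] at h
    filter_upwards [hg, hR.den_eventually_eq,
      eventually_cons hg.self_of_nhds.2.continuousAt h] with γ hγ hRγ hEγ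
    rw [Trace.den_letin, hγ.1, Part.bind_some, ← hEγ,
      ECtx.den_plugVar E (hRγ.trans hγ.1)]
  | _, _, _, φ, ρ, _, _,
    @SymEval.bctx _ _ _ _ _ _ E R b C _ hR hE => by
    have hRb := hR.den_eq
    have hEC := hE.den_eventually_eq
    -- the truth value of `R` is the same near `⟦ρ⟧`
    obtain ⟨b', hb'⟩ := R.regularAt_den φ.smooth_den (γ := VEnv.den ρ) (by rw [hRb]; trivial)
    obtain rfl : b' = b := Part.some_injective (hb'.self_of_nhds.symm.trans hRb)
    filter_upwards [hb', hEC] with γ hγ hEγ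
    rw [← hEγ]
    exact ECtx.den_plug_congr E hγ

end

end Evaluation

end DiffLang

theorem theorem1 (σ : DiffLang.Signature) {Φ : DiffLang.FCtx} {Γ : DiffLang.Ctx}
    (φ : DiffLang.FEnv σ Φ) (ρ : DiffLang.VEnv Γ) :
    (∀ (T : DiffLang.Ty) (M : DiffLang.Term σ Φ Γ T) (V : DiffLang.CVal T),
      DiffLang.Eval (k := .ty T) φ ρ M V →
        M.den (DiffLang.FEnv.den φ) (DiffLang.VEnv.den ρ) = Part.some V.den) ∧
    (∀ (B : DiffLang.BTerm σ Φ Γ) (b : Bool),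
      DiffLang.Eval (k := .bool) φ ρ B b →
        B.den (DiffLang.FEnv.den φ) (DiffLang.VEnv.den ρ) = Part.some b) ∧
    (∀ (T : DiffLang.Ty) (M : DiffLang.Term σ Φ Γ T) (C : DiffLang.Trace σ Γ T),
      DiffLang.SymEval φ ρ M C →
        ∃ O : Set (DiffLang.DCtx Γ), IsOpen O ∧ DiffLang.VEnv.den ρ ∈ O ∧
          ∀ γ ∈ O, M.den (DiffLang.FEnv.den φ) γ = C.den γ) := by
  refine ⟨fun T M V h => h.den_eq, fun B b h => h.den_eq, fun T M C h => ?_⟩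
  obtain ⟨O, hO, hopen, hρ⟩ := eventually_nhds_iff.1 h.den_eventually_eq
  exact ⟨O, hopen, hρ, hO⟩
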